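/- Let $\kappa<0$. A plane curve $\alpha(s)=(x(s),z(s))$, $s\in\mathbb R$, of class $C^2$ and parametrized by arc length, is the directrix of a $\kappa$-cylindrical surface if the cylinder $X(s,t)=(x(s),t,z(s))$ has mean curvature $H$ with $2H=\kappa z$ (with respect to the unit normal $X_s\times X_t/|X_s\times X_t|$). It is normalized by $\alpha(0)=(0,z_0)$, $\alpha'(0)=(1,0)$; equivalently, $x'=\cos\theta$, $z'=\sin\theta$, $\theta'=\kappa z$, $x(0)=0$, $z(0)=z_0$, $\theta(0)=0$. A double point of $\alpha$ is given by parameters $s\neq t$ with $\alpha(s)=\alpha(t)$; $\alpha$ meets itself there tangentially if $\alpha'(s)$ and $\alpha'(t)$ are linearly dependent, and transversally otherwise. Theorem. There are numbers $z_1,z_2$, depending only on $\kappa$, with $$-\frac{2}{\sqrt{-\kappa}}<z_2<z_1<-\frac{\sqrt2}{\sqrt{-\kappa}},$$ and a countable set $B\subset\mathbb R$, such that for every $z_0$ with $-\frac{2}{\sqrt{-\kappa}}<z_0<-\sqrt{-2/\kappa}$ and every such directrix $\alpha$ the following holds. The function $z$ has a least positive period $T$, and $\alpha(s+T)=\alpha(s)+(x(T),0)$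 for all $s$. Moreover: 1. If $z_1<z_0$, then $\alpha$ has no double points and $x(s)\to\infty$ as $s\to\infty$. 2. If $z_0=z_1$, then $\alpha$ has double points, $\alpha$ meets itself tangentially at every one of them, $x(s)\ge 0$ for all $s\ge 0$, and $x(s)\to\infty$ as $s\to\infty$. 3. If $z_2<z_0<z_1$, then there are double points $\alpha(s)=\alpha(t)$ with $0<|s-t|<T$, and $\alpha$ meets itself transversally at each of these; if moreover $z_0\notin B$, then $\alpha$ meets itself transversally at all its double points. Also $x(s)\to\infty$ as $s\to\infty$. 4. If $z_0=z_2$, then $\alpha$ is a closed curve, $\alpha(s+T)=\alpha(s)$ for all $s$, and the origin is its only double point: there are $s\ne t$ in $[0,T)$ with $\alpha(s)=\alpha(t)=p$ if and only if $p=(0,0)$. 5. If $z_0<z_2$, then there are double points $\alpha(s)=\alpha(t)$ with $0<|s-t|<T$, and $\alpha$ meets itself transversally at each of these; if moreover $z_0\notin B$, then $\alpha$ meets itself transversally at all its double points. Also $x(s)\to-\infty$ as $s\to\infty$. -/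

import Mathlib

open Filter Function

namespace CapillaryChannel

/-- First partial derivative in the first variable of a parametrized surface in `ℝ³`. -/
noncomputable def partialS (X : ℝ → ℝ → Fin 3 → ℝ) (s t : ℝ) : Fin 3 → ℝ :=
  deriv (fun s' => X s' t) s

/-- First partial derivative in the second variable of a parametrized surface in `ℝ³`. -/
noncomputable def partialT (X : ℝ → ℝ → Fin 3 → ℝ) (s t : ℝ) : Fin 3 → ℝ :=
  deriv (fun t' => X s t') t

/-- The unit normal `(X_s × X_t) / |X_s × X_t|` (Euclidean length). -/
noncomputable def unitNormal (X : ℝ → ℝ → Fin 3 → ℝ) (s t : ℝ) : Fin 3 → ℝ :=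
  let n := crossProduct (partialS X s t) (partialT X s t)
  (Real.sqrt (dotProduct n n))⁻¹ • n

/-- The mean curvature (half of the sum of the principal curvatures) of a parametrized surface
with respect to `unitNormal`, through the first and second fundamental forms. -/
noncomputable def meanCurvature (X : ℝ → ℝ → Fin 3 → ℝ) (s t : ℝ) : ℝ :=
  let E := dotProduct (partialS X s t) (partialS X s t)
  let F := dotProduct (partialS X s t) (partialT X s t)
  let G := dotProduct (partialT X s t) (partialT X s t)
  let L := dotProduct (partialS (partialS X) s t) (unitNormal X s t)
  let M := dotProduct (partialT (partialS X) s t) (unitNormal X s t)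
  let N := dotProduct (partialT (partialT X) s t) (unitNormal X s t)
  (E * N - 2 * F * M + G * L) / (2 * (E * G - F ^ 2))

/-- The cylindrical ruled surface over the curve `(x, z)` with horizontal rulings parallel to the
`y`-axis. -/
def cylinder (x z : ℝ → ℝ) (s t : ℝ) : Fin 3 → ℝ := ![x s, t, z s]

/-- `(x, z)` is the arc-length parametrized directrix of a `κ`-cylindrical surface (the mean
curvature satisfies `2 H = κ z`), normalized so that at `s = 0` it passes through `(0, z₀)` with
horizontal unit velocity `(1, 0)`. -/
structure IsDirectrix (κ z₀ : ℝ) (x z : ℝ → ℝ) : Prop where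
  contDiff_x : ContDiff ℝ 2 x
  contDiff_z : ContDiff ℝ 2 z
  unit_speed : ∀ s, deriv x s ^ 2 + deriv z s ^ 2 = 1
  capillary : ∀ s t, 2 * meanCurvature (cylinder x z) s t = κ * cylinder x z s t 2
  x_zero : x 0 = 0
  z_zero : z 0 = z₀
  velocity_x_zero : deriv x 0 = 1
  velocity_z_zero : deriv z 0 = 0

/-- The parameters `s ≠ t` give a double point of the curve `(x, z)`. -/
def Meets (x z : ℝ → ℝ) (s t : ℝ) : Prop := s ≠ t ∧ x s = x t ∧ z s = z t

/-- The velocity vectors of `(x, z)` at the parameters `s` and `t` are linearly dependent, that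
is, the tangent lines there are parallel. -/
def ParallelTangents (x z : ℝ → ℝ) (s t : ℝ) : Prop :=
  deriv x s * deriv z t - deriv z s * deriv x t = 0

/-- The curve meets itself tangentially at the parameters `s ≠ t`. -/
def MeetsTangentially (x z : ℝ → ℝ) (s t : ℝ) : Prop :=
  Meets x z s t ∧ ParallelTangents x z s t

/-- The curve meets itself transversally at the parameters `s ≠ t`. -/
def MeetsTransversally (x z : ℝ → ℝ) (s t : ℝ) : Prop :=
  Meets x z s t ∧ ¬ ParallelTangents x z s t

/-- `T` is the least positive period of the function `f`. -/
def IsLeastPeriod (f : ℝ → ℝ) (T : ℝ) : Prop :=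
  IsLeast {T : ℝ | 0 < T ∧ Function.Periodic f T} T

end CapillaryChannel

namespace CapillaryChannel

open Real intervalIntegral Set

/-! Put κ = -c² and z₀ = -2√m/c; the admissible heights are those with 1/2 < m < 1. With sin(θ/2) =
√m sin φ the system is solved by s = F(φ)/c, z = -(2√m/c) cos φ, x = a(φ)/c, where F is `ellipticF
m` and a is `abscissa m` (`IsDirectrix.amplitude`, by uniqueness for the ODE). All questions become
questions about a, which is odd and satisfies a(φ + π) = a(φ) + a(π).

On [0, π/2] the function a climbs by A = `advance m` and then drops by R = `retreat m`. By
reflection a(π) = 2(A - R), and the critical values of a on [0, π] are A and A - 2R. The sign of A -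
R gives the drift; the curve closes when A = R. Otherwise two points at equal height can coincide
only if their amplitudes are φ and -φ + 2nπ, and they do exactly when u = φ - nπ is a nonzero zero
of a. Such zeros exist if and only if A ≤ 2R.

The two tangents at such a double point mirror each other, so they are parallel only if vertical or
horizontal. Horizontal ones would force φ = nπ. Vertical ones put φ at a critical point of a, which
forces A = 2j(A - R) for an integer j; within one period only A = 2R is possible.

Since the rate decreases in q, R strictly increases with m while A does not increase. So R/A grows
strictly from 0 at m = 1/2 to beyond 1 near m = 1: the values 1/2 and 1 define z₁ and z₂, and each j
is resonant for at most one m, which makes B countable. -/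

/-- The rate of change `(1 - 2q) / √(1 - q)` of the abscissa of an elastica with respect to its
amplitude `φ`, where `q = m sin² φ`. -/
noncomputable def abscissaRate (q : ℝ) : ℝ := (1 - 2 * q) / √(1 - q)

/-- The incomplete elliptic integral of the first kind, of parameter `m`. -/
noncomputable def ellipticF (m φ : ℝ) : ℝ := ∫ t in (0 : ℝ)..φ, (√(1 - m * sin t ^ 2))⁻¹

/-- The abscissa of the elastica of parameter `m` at amplitude `φ`. -/
noncomputable def abscissa (m φ : ℝ) : ℝ := ∫ t in (0 : ℝ)..φ, abscissaRate (m * sin t ^ 2)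

/-- The total advance of the abscissa over a quarter of a period. -/
noncomputable def advance (m : ℝ) : ℝ :=
  ∫ t in (0 : ℝ)..(π / 2), max (abscissaRate (m * sin t ^ 2)) 0

/-- The total retreat of the abscissa over a quarter of a period. -/
noncomputable def retreat (m : ℝ) : ℝ :=
  ∫ t in (0 : ℝ)..(π / 2), max (-abscissaRate (m * sin t ^ 2)) 0

/-! ### Advance and retreat as functions of the parameter -/

lemma abscissaRate_strictAntiOn : StrictAntiOn abscissaRate (Iio 1) := by
  intro a ha b hb hab
  simp only [mem_Iio] at ha hb
  -- With r = √(1 - q) the rate is 2r - 1/r, increasing in r.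
  have h1 : ∀ q < (1 : ℝ), abscissaRate q = 2 * √(1 - q) - (√(1 - q))⁻¹ := by
    intro q hq
    have h : 0 < √(1 - q) := Real.sqrt_pos.2 (by linarith)
    have h2 := Real.sq_sqrt (show 0 ≤ 1 - q by linarith)
    unfold abscissaRate
    field_simp
    linarith
  rw [h1 a ha, h1 b hb]
  have h2 : √(1 - b) < √(1 - a) := Real.sqrt_lt_sqrt (by linarith) (by linarith)
  have h3 : 0 < √(1 - b) := Real.sqrt_pos.2 (by linarith)
  have h4 : (√(1 - a))⁻¹ < (√(1 - b))⁻¹ := inv_strictAnti₀ h3 h2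
  linarith

lemma one_sub_mul_sin_sq_pos {m : ℝ} (hm : m < 1) (t : ℝ) : 0 < 1 - m * sin t ^ 2 := by
  rcases eq_or_ne (sin t) 0 with h | h
  · simp [h]
  · nlinarith [sin_sq_add_cos_sq t, sq_nonneg (cos t),
      mul_pos (sub_pos.2 hm) (pow_pos (abs_pos.2 h) 2), sq_abs (sin t)]

lemma continuous_abscissaRate_uncurry :
    Continuous (uncurry fun (m : Iio (1 : ℝ)) (t : ℝ) => abscissaRate (m * sin t ^ 2)) := by
  unfold abscissaRate
  refine Continuous.div (by fun_prop) (by fun_prop) ?_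
  rintro ⟨⟨m, hm⟩, t⟩
  exact (Real.sqrt_pos.2 (one_sub_mul_sin_sq_pos hm t)).ne'

lemma continuous_abscissaRate {m : ℝ} (hm : m < 1) :
    Continuous fun t : ℝ => abscissaRate (m * sin t ^ 2) :=
  continuous_abscissaRate_uncurry.comp (Continuous.prodMk_right (⟨m, hm⟩ : Iio (1 : ℝ)))

lemma continuous_inv_sqrt {m : ℝ} (hm : m < 1) :
    Continuous fun t : ℝ => (√(1 - m * sin t ^ 2))⁻¹ :=
  Continuous.inv₀ (by fun_prop) fun t => (Real.sqrt_pos.2 (one_sub_mul_sin_sq_pos hm t)).ne'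

lemma continuousOn_advance : ContinuousOn advance (Iio 1) := by
  rw [continuousOn_iff_continuous_domRestrict]
  exact continuous_parametric_intervalIntegral_of_continuous'
    (f := fun (m : Iio (1 : ℝ)) (t : ℝ) => max (abscissaRate (m * sin t ^ 2)) 0)
    (continuous_abscissaRate_uncurry.max continuous_const) 0 (π / 2)

lemma continuousOn_retreat : ContinuousOn retreat (Iio 1) := by
  rw [continuousOn_iff_continuous_domRestrict]
  exact continuous_parametric_intervalIntegral_of_continuous'
    (f := fun (m : Iio (1 : ℝ)) (t : ℝ) => max (-abscissaRate (m * sin t ^ 2)) 0)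
    (continuous_abscissaRate_uncurry.neg.max continuous_const) 0 (π / 2)

lemma abscissaRate_pos_iff {q : ℝ} (hq : q < 1) : 0 < abscissaRate q ↔ q < 1 / 2 := by
  have h : 0 < √(1 - q) := Real.sqrt_pos.2 (by linarith)
  rw [abscissaRate, div_pos_iff_of_pos_right h]
  constructor <;> intro h <;> linarith

lemma abscissaRate_neg_iff {q : ℝ} (hq : q < 1) : abscissaRate q < 0 ↔ 1 / 2 < q := by
  have h : 0 < √(1 - q) := Real.sqrt_pos.2 (by linarith)
  rw [abscissaRate, div_neg_iff]
  constructor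
  · rintro (⟨h1, h2⟩ | ⟨h1, h2⟩) <;> linarith
  · intro h1; right; exact ⟨by linarith, h⟩

lemma mul_sin_sq_lt_one {m : ℝ} (hm : m < 1) (t : ℝ) : m * sin t ^ 2 < 1 := by
  linarith [one_sub_mul_sin_sq_pos hm t]

lemma abscissaRate_anti {m m' : ℝ} (h : m ≤ m') (hm' : m' < 1) (t : ℝ) :
    abscissaRate (m' * sin t ^ 2) ≤ abscissaRate (m * sin t ^ 2) :=
  abscissaRate_strictAntiOn.antitoneOn (mul_sin_sq_lt_one (h.trans_lt hm') t)
    (mul_sin_sq_lt_one hm' t) (by gcongr)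

lemma advance_antitone {m m' : ℝ} (h : m ≤ m') (hm' : m' < 1) : advance m' ≤ advance m := by
  refine integral_mono_on (by positivity) ?_ ?_ ?_
  · exact ((continuous_abscissaRate hm').max continuous_const).intervalIntegrable _ _
  · exact ((continuous_abscissaRate (h.trans_lt hm')).max continuous_const).intervalIntegrable _ _
  · intro t _
    exact max_le_max (abscissaRate_anti h hm' t) le_rfl

lemma advance_pos {m : ℝ} (hm : m < 1) : 0 < advance m := by
  have hp := pi_pos
  refine intervalIntegral.integral_pos (by positivity)
    ((continuous_abscissaRate hm).max continuous_const).continuousOn (fun t _ => le_max_right _ _)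
    ⟨0, by constructor <;> linarith, ?_⟩
  simp [abscissaRate]

lemma retreat_strictMono {m m' : ℝ} (h : m < m') (h0 : 1 / 2 ≤ m) (hm' : m' < 1) :
    retreat m < retreat m' := by
  have hp := pi_pos
  refine integral_lt_integral_of_continuousOn_of_le_of_exists_lt (by positivity) ?_ ?_ ?_ ?_
  · exact ((continuous_abscissaRate (h.trans hm')).neg.max continuous_const).continuousOn
  · exact ((continuous_abscissaRate hm').neg.max continuous_const).continuousOn
  · intro t _
    exact max_le_max (neg_le_neg (abscissaRate_anti h.le hm' t)) le_rfl
  -- At the quarter period q equals the parameter itself, and m' > 1/2 makes the larger retreat rate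
  -- strictly positive there.
  · refine ⟨π / 2, ⟨by positivity, le_rfl⟩, ?_⟩
    rw [sin_pi_div_two, one_pow, mul_one, mul_one]
    have h1 := (abscissaRate_neg_iff hm').2 (by linarith)
    have h2 := abscissaRate_strictAntiOn (show m ∈ Iio 1 from h.trans hm') hm' h
    exact max_lt (lt_max_of_lt_left (by linarith)) (lt_max_of_lt_left (by linarith))

lemma retreat_half : retreat (1 / 2) = 0 := by
  have : ∀ t : ℝ, max (-abscissaRate (1 / 2 * sin t ^ 2)) 0 = 0 := by
    intro t
    refine max_eq_right ?_
    have := mt (abscissaRate_neg_iff (mul_sin_sq_lt_one (m := 1 / 2) (by norm_num) t)).1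
      (by nlinarith [sin_sq_add_cos_sq t, sq_nonneg (cos t)])
    linarith
  simp only [retreat, this, integral_zero]

lemma retreat_pos {m : ℝ} (h0 : 1 / 2 < m) (hm : m < 1) : 0 < retreat m :=
  retreat_half ▸ retreat_strictMono h0 le_rfl hm

lemma advance_sub_retreat {m : ℝ} (hm : m < 1) :
    abscissa m (π / 2) = advance m - retreat m := by
  rw [abscissa, advance, retreat, ← integral_sub]
  · refine integral_congr fun t _ => ?_
    rcases le_total 0 (abscissaRate (m * sin t ^ 2)) with h | h
    · rw [max_eq_left h, max_eq_right (by linarith)]; ring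
    · rw [max_eq_right h, max_eq_left (by linarith)]; ring
  · exact ((continuous_abscissaRate hm).max continuous_const).intervalIntegrable _ _
  · exact ((continuous_abscissaRate hm).neg.max continuous_const).intervalIntegrable _ _

/-! ### The two thresholds and the resonances -/

/-- As m → 1 the rate near π/2 approaches -1/(π/2 - t), so its integral diverges logarithmically to
-∞. For m = 1 - δ² the integral is at most π - log((δ + π/2)/δ); δ = exp(-4) suffices because π < 4.
-/
lemma exists_advance_lt_retreat : ∃ m : ℝ, 1 / 2 < m ∧ m < 1 ∧ advance m < retreat m := by
  set δ := exp (-4) with hδ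
  have hδ0 : 0 < δ := exp_pos _
  have hδ1 : δ < 1 / 4 := by
    have : (4 : ℝ) + 1 ≤ exp 4 := add_one_le_exp 4
    rw [hδ, exp_neg, inv_lt_comm₀ (exp_pos _) (by norm_num)]
    norm_num; linarith
  have hp := pi_pos
  have hm1 : 1 - δ ^ 2 < 1 := by nlinarith
  refine ⟨1 - δ ^ 2, by nlinarith, hm1, ?_⟩
  rw [← sub_neg, ← advance_sub_retreat hm1, abscissa]
  have hle : ∀ t ∈ Icc 0 (π / 2), abscissaRate ((1 - δ ^ 2) * sin t ^ 2) ≤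
      2 - (δ + (π / 2 - t))⁻¹ := by
    intro t ht
    set a := √(1 - (1 - δ ^ 2) * sin t ^ 2) with ha
    have hq := one_sub_mul_sin_sq_pos hm1 t
    have ha0 : 0 < a := Real.sqrt_pos.2 hq
    have ha2 : a ^ 2 = 1 - (1 - δ ^ 2) * sin t ^ 2 := Real.sq_sqrt hq.le
    have h1 : abscissaRate ((1 - δ ^ 2) * sin t ^ 2) = 2 * a - a⁻¹ := by
      unfold abscissaRate
      rw [← ha]
      field_simp
      linarith
    have ha1 : a ≤ 1 := by
      nlinarith [mul_nonneg (show 0 ≤ 1 - δ ^ 2 by nlinarith) (sq_nonneg (sin t))]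
    have hc : cos t ≤ π / 2 - t := by
      rw [← sin_pi_div_two_sub]; exact sin_le (by linarith [ht.2])
    have hc0 : 0 ≤ cos t := cos_nonneg_of_mem_Icc ⟨by linarith [ht.1], ht.2⟩
    -- Here a² = cos² t + δ² sin² t, and cos t ≤ π/2 - t.
    have h2 : a ≤ δ + (π / 2 - t) := by
      refine abs_le_of_sq_le_sq' ?_ (by linarith [ht.2]) |>.2
      have := sin_sq_add_cos_sq t
      nlinarith [mul_nonneg hδ0.le (sub_nonneg.2 ht.2), sq_nonneg (δ * cos t),
        pow_le_pow_left₀ hc0 hc 2]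
    have h3 : (δ + (π / 2 - t))⁻¹ ≤ a⁻¹ := inv_anti₀ ha0 h2
    linarith
  have hci : ContinuousOn (fun t : ℝ => (δ + (π / 2 - t))⁻¹) (uIcc 0 (π / 2)) := by
    refine ContinuousOn.inv₀ (by fun_prop) ?_
    intro t ht
    rw [uIcc_of_le (by positivity)] at ht
    exact (add_pos_of_pos_of_nonneg hδ0 (sub_nonneg.2 ht.2)).ne'
  have hcont : ContinuousOn (fun t : ℝ => 2 - (δ + (π / 2 - t))⁻¹) (uIcc 0 (π / 2)) :=
    continuousOn_const.sub hci
  have hint : ∫ t in (0 : ℝ)..(π / 2), (2 - (δ + (π / 2 - t))⁻¹) = π - log ((δ + π / 2) / δ) := by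
    rw [integral_sub (by simp) hci.intervalIntegrable, integral_const]
    have h1 : ∀ t : ℝ, (δ + (π / 2 - t))⁻¹ = ((δ + π / 2) - t)⁻¹ := fun t => by ring_nf
    simp only [h1]
    rw [integral_comp_sub_left (fun u => u⁻¹) (δ + π / 2), sub_zero, add_sub_cancel_right,
      integral_inv_of_pos hδ0 (by linarith)]
    simp
  have hlog : 4 < log ((δ + π / 2) / δ) := by
    rw [log_div (by linarith) hδ0.ne', hδ, log_exp]
    have : 0 < log (exp (-4) + π / 2) := log_pos (by linarith [pi_gt_three])
    linarith
  calc _ ≤ ∫ t in (0 : ℝ)..(π / 2), (2 - (δ + (π / 2 - t))⁻¹) :=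
        integral_mono_on (by positivity) ((continuous_abscissaRate hm1).intervalIntegrable _ _)
          hcont.intervalIntegrable hle
    _ < 0 := by rw [hint]; linarith [pi_lt_d2]

/-- The ratio of retreat to advance takes every positive value below a given attained one. -/
lemma exists_retreat_eq_mul_advance {m a : ℝ} (h0 : 1 / 2 < m) (hm : m < 1) (ha : 0 < a)
    (h : a * advance m < retreat m) : ∃ m', 1 / 2 < m' ∧ m' < m ∧ retreat m' = a * advance m' := by
  have hsub : Icc (1 / 2) m ⊆ Iio 1 := fun t ht => ht.2.trans_lt hm
  have hc : ContinuousOn (fun m => retreat m - a * advance m) (Icc (1 / 2) m) :=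
    (continuousOn_retreat.mono hsub).sub (continuousOn_const.mul (continuousOn_advance.mono hsub))
  have h1 : retreat (1 / 2) - a * advance (1 / 2) < 0 := by
    rw [retreat_half]
    have := mul_pos ha (advance_pos (m := 1 / 2) (by norm_num))
    linarith
  obtain ⟨m', hm', he⟩ := intermediate_value_Ioo h0.le hc ⟨h1, sub_pos.2 h⟩
  exact ⟨m', hm'.1, hm'.2, sub_eq_zero.1 he⟩

/-- The ratio of retreat to advance is strictly increasing. -/
lemma retreat_sub_mul_advance_strictMono {a m m' : ℝ} (ha : 0 ≤ a) (h : m < m') (h0 : 1 / 2 ≤ m)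
    (hm' : m' < 1) : retreat m - a * advance m < retreat m' - a * advance m' := by
  have h1 := retreat_strictMono h h0 hm'
  have h2 := mul_le_mul_of_nonneg_left (advance_antitone h.le hm') ha
  linarith

/-- The intermediate value argument is run for ratio 1 first, then for ratio 1/2 below m₂, so the
order m₁ < m₂ comes for free. -/
lemma exists_thresholds : ∃ m₁ m₂ : ℝ, 1 / 2 < m₁ ∧ m₁ < m₂ ∧ m₂ < 1 ∧
    2 * retreat m₁ = advance m₁ ∧ retreat m₂ = advance m₂ := by
  obtain ⟨m, h0, h1, h⟩ := exists_advance_lt_retreat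
  obtain ⟨m₂, h2, h3, h4⟩ := exists_retreat_eq_mul_advance (a := 1) h0 h1 one_pos (by linarith)
  have hp := advance_pos (h3.trans h1)
  obtain ⟨m₁, h5, h6, h7⟩ := exists_retreat_eq_mul_advance (a := 1 / 2) h2 (h3.trans h1)
    (by norm_num) (by linarith)
  exact ⟨m₁, m₂, h5, h6, h3.trans h1, by linarith, by linarith⟩

/-- The equation prescribes R/A = 1 - 1/(2j), and R/A is strictly increasing. -/
lemma subsingleton_resonance (j : ℤ) :
    {m : ℝ | 1 / 2 < m ∧ m < 1 ∧ advance m = 2 * j * (advance m - retreat m)}.Subsingleton := by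
  have key : ∀ m m' : ℝ, 1 / 2 < m → m' < 1 → m < m' →
      advance m = 2 * j * (advance m - retreat m) →
      advance m' = 2 * j * (advance m' - retreat m') → False := by
    intro m m' h0 h1 h e e'
    have hp := advance_pos (h.trans h1)
    have hp' := advance_pos h1
    have hj : (j : ℝ) ≠ 0 := by
      intro hj; rw [hj] at e; simp at e; linarith
    have hr := retreat_pos h0 (h.trans h1)
    have e1 : retreat m = (1 - 1 / (2 * j)) * advance m := by field_simp; linarith
    have e2 : retreat m' = (1 - 1 / (2 * j)) * advance m' := by field_simp; linarith
    have ha : 0 ≤ 1 - 1 / (2 * (j : ℝ)) := by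
      by_contra! hneg
      nlinarith [mul_pos hp (neg_pos.2 hneg)]
    linarith [retreat_sub_mul_advance_strictMono ha h h0.le h1]
  rintro m ⟨h0, h1, e⟩ m' ⟨h0', h1', e'⟩
  rcases lt_trichotomy m m' with h | h | h
  · exact (key m m' h0 h1' h e e').elim
  · exact h
  · exact (key m' m h0' h1 h e' e).elim

/-! ### Symmetries of the elliptic integrals -/

section Primitive

variable {f : ℝ → ℝ}

lemma integral_add_int_mul_pi (hf : Continuous f) (hper : Periodic f π) (φ : ℝ) (n : ℤ) :
    ∫ t in (0 : ℝ)..(φ + n * π), f t = (∫ t in (0 : ℝ)..φ, f t) + n * ∫ t in (0 : ℝ)..π, f t := by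
  rw [← integral_add_adjacent_intervals (hf.intervalIntegrable 0 φ)
    (hf.intervalIntegrable φ _), ← zsmul_eq_mul, hper.intervalIntegral_add_zsmul_eq n φ
    (fun a b => hf.intervalIntegrable a b), hper.intervalIntegral_add_eq φ 0]
  simp

lemma integral_neg_of_even (heven : ∀ t, f (-t) = f t) (φ : ℝ) :
    ∫ t in (0 : ℝ)..(-φ), f t = -∫ t in (0 : ℝ)..φ, f t := by
  have := integral_comp_neg (a := 0) (b := φ) f
  simp only [heven, neg_zero] at this
  rw [this, integral_symm]

end Primitive

lemma sin_sq_periodic (g : ℝ → ℝ) : Periodic (fun t => g (sin t ^ 2)) π := fun t => by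
  simp [sin_add_pi]

lemma hasDerivAt_abscissa {m : ℝ} (hm : m < 1) (φ : ℝ) :
    HasDerivAt (abscissa m) (abscissaRate (m * sin φ ^ 2)) φ :=
  ((continuous_abscissaRate hm).integral_hasStrictDerivAt 0 φ).hasDerivAt

lemma continuous_abscissa {m : ℝ} (hm : m < 1) : Continuous (abscissa m) :=
  continuous_iff_continuousAt.2 fun φ => (hasDerivAt_abscissa hm φ).continuousAt

lemma abscissa_zero (m : ℝ) : abscissa m 0 = 0 := integral_same

lemma abscissa_neg (m φ : ℝ) : abscissa m (-φ) = -abscissa m φ :=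
  integral_neg_of_even (fun t => by simp) φ

lemma abscissa_add_int_mul_pi {m : ℝ} (hm : m < 1) (φ : ℝ) (n : ℤ) :
    abscissa m (φ + n * π) = abscissa m φ + n * abscissa m π :=
  integral_add_int_mul_pi (continuous_abscissaRate hm)
    (sin_sq_periodic fun q => abscissaRate (m * q)) φ n

/-- Oddness combined with the shift by π: a point reflection about π/2, which reduces the second
quarter period to the first. -/
lemma abscissa_pi_sub {m : ℝ} (hm : m < 1) (φ : ℝ) :
    abscissa m (π - φ) = abscissa m π - abscissa m φ := by
  have := abscissa_add_int_mul_pi hm (-φ) 1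
  rw [abscissa_neg] at this
  push_cast at this
  rw [one_mul, one_mul] at this
  rw [sub_eq_neg_add, this]; ring

lemma abscissa_pi {m : ℝ} (hm : m < 1) :
    abscissa m π = 2 * (advance m - retreat m) := by
  have h := abscissa_pi_sub hm (π / 2)
  rw [show π - π / 2 = π / 2 by ring, advance_sub_retreat hm] at h
  linarith

lemma hasDerivAt_ellipticF {m : ℝ} (hm : m < 1) (φ : ℝ) :
    HasDerivAt (ellipticF m) (√(1 - m * sin φ ^ 2))⁻¹ φ :=
  ((continuous_inv_sqrt hm).integral_hasStrictDerivAt 0 φ).hasDerivAt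

lemma continuous_ellipticF {m : ℝ} (hm : m < 1) : Continuous (ellipticF m) :=
  continuous_iff_continuousAt.2 fun φ => (hasDerivAt_ellipticF hm φ).continuousAt

lemma ellipticF_zero (m : ℝ) : ellipticF m 0 = 0 := integral_same

lemma ellipticF_neg (m φ : ℝ) : ellipticF m (-φ) = -ellipticF m φ :=
  integral_neg_of_even (fun t => by simp) φ

lemma ellipticF_add_int_mul_pi {m : ℝ} (hm : m < 1) (φ : ℝ) (n : ℤ) :
    ellipticF m (φ + n * π) = ellipticF m φ + n * ellipticF m π :=
  integral_add_int_mul_pi (continuous_inv_sqrt hm)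
    (sin_sq_periodic fun q => (√(1 - m * q))⁻¹) φ n

lemma ellipticF_strictMono {m : ℝ} (hm : m < 1) : StrictMono (ellipticF m) :=
  strictMono_of_deriv_pos fun φ => by
    rw [(hasDerivAt_ellipticF hm φ).deriv]
    exact inv_pos.2 (Real.sqrt_pos.2 (one_sub_mul_sin_sq_pos hm φ))

lemma ellipticF_pi_pos {m : ℝ} (hm : m < 1) : 0 < ellipticF m π := by
  rw [← ellipticF_zero m]; exact ellipticF_strictMono hm pi_pos

lemma ellipticF_surjective {m : ℝ} (hm : m < 1) : Surjective (ellipticF m) := by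
  intro y
  have hp := ellipticF_pi_pos hm
  obtain ⟨n, hn⟩ := exists_int_gt (y / ellipticF m π)
  obtain ⟨k, hk⟩ := exists_int_lt (y / ellipticF m π)
  rw [div_lt_iff₀ hp] at hn
  rw [lt_div_iff₀ hp] at hk
  have h : ∀ n : ℤ, ellipticF m (n * π) = n * ellipticF m π := fun n => by
    simpa [ellipticF_zero] using ellipticF_add_int_mul_pi hm 0 n
  exact mem_range_of_exists_le_of_exists_ge (continuous_ellipticF hm)
    ⟨k * π, by rw [h]; exact hk.le⟩ ⟨n * π, by rw [h]; exact hn.le⟩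

/-! ### Shape of the abscissa and its zeros -/

/-- The turning point of the abscissa in the first quarter of a period. -/
noncomputable def turning (m : ℝ) : ℝ := arcsin (√(1 / (2 * m)))

section Turning

variable {m : ℝ}

lemma turning_arg_mem (h0 : 1 / 2 < m) : 0 < √(1 / (2 * m)) ∧ √(1 / (2 * m)) < 1 := by
  have h : 0 < 2 * m := by linarith
  refine ⟨Real.sqrt_pos.2 (by positivity), ?_⟩
  rw [Real.sqrt_lt' one_pos, div_lt_iff₀ h]
  linarith

lemma turning_pos (h0 : 1 / 2 < m) : 0 < turning m := arcsin_pos.2 (turning_arg_mem h0).1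

lemma turning_lt (h0 : 1 / 2 < m) : turning m < π / 2 :=
  arcsin_lt_pi_div_two.2 (turning_arg_mem h0).2

lemma mul_sin_turning_sq (h0 : 1 / 2 < m) : m * sin (turning m) ^ 2 = 1 / 2 := by
  have h := turning_arg_mem h0
  rw [turning, sin_arcsin (by linarith) h.2.le, Real.sq_sqrt (by positivity)]
  field_simp

lemma mul_sin_sq_lt_half (h0 : 1 / 2 < m) {t : ℝ} (ht : 0 ≤ t) (h : t < turning m) :
    m * sin t ^ 2 < 1 / 2 := by
  have hlt := turning_lt h0
  have hs : sin t < sin (turning m) :=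
    sin_lt_sin_of_lt_of_le_pi_div_two (by linarith [pi_pos]) hlt.le h
  have hs0 : 0 ≤ sin t := sin_nonneg_of_nonneg_of_le_pi ht (by linarith)
  rw [← mul_sin_turning_sq h0]
  have := pow_lt_pow_left₀ hs hs0 two_ne_zero
  gcongr

lemma half_lt_mul_sin_sq (h0 : 1 / 2 < m) {t : ℝ} (ht : t ≤ π / 2) (h : turning m < t) :
    1 / 2 < m * sin t ^ 2 := by
  have hpos := turning_pos h0
  have hs : sin (turning m) < sin t :=
    sin_lt_sin_of_lt_of_le_pi_div_two (by linarith [pi_pos]) ht h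
  have hs0 : 0 ≤ sin (turning m) :=
    sin_nonneg_of_nonneg_of_le_pi hpos.le (by linarith [pi_pos])
  rw [← mul_sin_turning_sq h0]
  have := pow_lt_pow_left₀ hs hs0 two_ne_zero
  gcongr

lemma abscissa_strictMonoOn (h0 : 1 / 2 < m) (hm : m < 1) :
    StrictMonoOn (abscissa m) (Icc 0 (turning m)) := by
  refine strictMonoOn_of_deriv_pos (convex_Icc _ _) (continuous_abscissa hm).continuousOn ?_
  intro t ht
  rw [interior_Icc] at ht
  rw [(hasDerivAt_abscissa hm t).deriv, abscissaRate_pos_iff (mul_sin_sq_lt_one hm t)]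
  exact mul_sin_sq_lt_half h0 ht.1.le ht.2

lemma abscissa_strictAntiOn (h0 : 1 / 2 < m) (hm : m < 1) :
    StrictAntiOn (abscissa m) (Icc (turning m) (π / 2)) := by
  refine strictAntiOn_of_deriv_neg (convex_Icc _ _) (continuous_abscissa hm).continuousOn ?_
  intro t ht
  rw [interior_Icc] at ht
  rw [(hasDerivAt_abscissa hm t).deriv, abscissaRate_neg_iff (mul_sin_sq_lt_one hm t)]
  exact half_lt_mul_sin_sq h0 ht.2.le ht.1

lemma abscissa_turning (h0 : 1 / 2 < m) (hm : m < 1) : abscissa m (turning m) = advance m := by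
  have hc := (continuous_abscissaRate hm).max (continuous_const (y := (0 : ℝ)))
  have h1 := turning_pos h0
  have h2 := turning_lt h0
  rw [advance, ← integral_add_adjacent_intervals (hc.intervalIntegrable 0 (turning m))
    (hc.intervalIntegrable (turning m) (π / 2)), abscissa]
  have e1 : ∫ t in (0 : ℝ)..(turning m), max (abscissaRate (m * sin t ^ 2)) 0 =
      ∫ t in (0 : ℝ)..(turning m), abscissaRate (m * sin t ^ 2) := by
    refine integral_congr fun t ht => ?_
    rw [uIcc_of_le h1.le] at ht
    refine max_eq_left ?_
    rcases ht.2.lt_or_eq with h | h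
    · exact ((abscissaRate_pos_iff (mul_sin_sq_lt_one hm t)).2
        (mul_sin_sq_lt_half h0 ht.1 h)).le
    · rw [h, mul_sin_turning_sq h0]; norm_num [abscissaRate]
  have e2 : ∫ t in (turning m)..(π / 2), max (abscissaRate (m * sin t ^ 2)) 0 =
      ∫ t in (turning m)..(π / 2), (0 : ℝ) := by
    refine integral_congr fun t ht => ?_
    rw [uIcc_of_le h2.le] at ht
    refine max_eq_right ?_
    rcases ht.1.lt_or_eq with h | h
    · exact ((abscissaRate_neg_iff (mul_sin_sq_lt_one hm t)).2
        (half_lt_mul_sin_sq h0 ht.2 h)).le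
    · rw [← h, mul_sin_turning_sq h0]; norm_num [abscissaRate]
  rw [e1, e2]
  simp

lemma abscissa_le_advance (h0 : 1 / 2 < m) (hm : m < 1) {t : ℝ} (ht : t ∈ Icc 0 (π / 2)) :
    abscissa m t ≤ advance m ∧ (abscissa m t = advance m → t = turning m) := by
  have h1 := turning_pos h0
  have h2 := turning_lt h0
  rw [← abscissa_turning h0 hm]
  rcases lt_trichotomy t (turning m) with h | h | h
  · have := abscissa_strictMonoOn h0 hm ⟨ht.1, h.le⟩ ⟨h1.le, le_rfl⟩ h
    exact ⟨this.le, fun e => (this.ne e).elim⟩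
  · exact ⟨by rw [h], fun _ => h⟩
  · have := abscissa_strictAntiOn h0 hm ⟨le_rfl, h2.le⟩ ⟨h.le, ht.2⟩ h
    exact ⟨this.le, fun e => (this.ne e).elim⟩

/-- The abscissa rises from 0, then falls strictly towards A - R ≥ 0 at π/2. -/
lemma abscissa_pos (h0 : 1 / 2 < m) (hm : m < 1) (h : retreat m ≤ advance m) {t : ℝ}
    (ht : t ∈ Ioo 0 (π / 2)) : 0 < abscissa m t := by
  rcases le_or_gt t (turning m) with hle | hgt
  · rw [← abscissa_zero m]
    exact abscissa_strictMonoOn h0 hm ⟨le_rfl, ht.1.le.trans hle⟩ ⟨ht.1.le, hle⟩ ht.1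
  · have := abscissa_strictAntiOn h0 hm ⟨hgt.le, ht.2.le⟩ ⟨hgt.le.trans ht.2.le, le_rfl⟩ ht.2
    rw [advance_sub_retreat hm] at this
    linarith

lemma eq_turning_of_mul_sin_sq (h0 : 1 / 2 < m) {t : ℝ} (ht : t ∈ Icc 0 π)
    (h : m * sin t ^ 2 = 1 / 2) : t = turning m ∨ t = π - turning m := by
  have key : ∀ u ∈ Icc 0 (π / 2), m * sin u ^ 2 = 1 / 2 → u = turning m := by
    intro u hu h
    rcases lt_trichotomy u (turning m) with h' | h' | h'
    · exact absurd h (mul_sin_sq_lt_half h0 hu.1 h').ne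
    · exact h'
    · exact absurd h (half_lt_mul_sin_sq h0 hu.2 h').ne'
  rcases le_total t (π / 2) with h' | h'
  · exact Or.inl (key t ⟨ht.1, h'⟩ h)
  · right
    have := key (π - t) ⟨by linarith [ht.2], by linarith⟩ (by rwa [sin_pi_sub])
    linarith

lemma abscissa_pi_sub_turning (h0 : 1 / 2 < m) (hm : m < 1) :
    abscissa m (π - turning m) = advance m - 2 * retreat m := by
  rw [abscissa_pi_sub hm, abscissa_pi hm, abscissa_turning h0 hm]; ring

/-- Values of the abscissa at its critical points, up to a full number of half periods. -/
lemma abscissa_critical (h0 : 1 / 2 < m) (hm : m < 1) {t : ℝ} (ht : t ∈ Icc 0 π)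
    (h : m * sin t ^ 2 = 1 / 2) :
    abscissa m t = advance m ∨ abscissa m t = advance m - 2 * retreat m := by
  rcases eq_turning_of_mul_sin_sq h0 ht h with h | h
  · left; rw [h, abscissa_turning h0 hm]
  · right; rw [h, abscissa_pi_sub_turning h0 hm]

/-- The reflection about π/2 turns the maximum A at the turning point into the minimum A - 2R. -/
lemma abscissa_ge (h0 : 1 / 2 < m) (hm : m < 1) {t : ℝ} (ht : t ∈ Icc (π / 2) π) :
    advance m - 2 * retreat m ≤ abscissa m t ∧
      (abscissa m t = advance m - 2 * retreat m → t = π - turning m) := by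
  have h := abscissa_le_advance h0 hm (t := π - t) ⟨by linarith [ht.2], by linarith [ht.1]⟩
  rw [abscissa_pi_sub hm, abscissa_pi hm] at h
  refine ⟨by linarith [h.1], fun e => ?_⟩
  linarith [h.2 (by linarith)]

/-- Every amplitude is a whole number of half periods plus a remainder in `[0, π)`. -/
lemma exists_eq_add_int_mul_pi (φ : ℝ) : ∃ u ∈ Ico 0 π, ∃ n : ℤ, φ = u + n * π := by
  obtain ⟨n, hn, -⟩ := existsUnique_sub_zsmul_mem_Ico pi_pos φ 0
  rw [zero_add, zsmul_eq_mul] at hn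
  exact ⟨_, hn, n, by ring⟩

lemma sin_add_int_mul_pi_sq (u : ℝ) (n : ℤ) : sin (u + n * π) ^ 2 = sin u ^ 2 := by
  rw [sin_sq, sin_sq, cos_add_int_mul_pi, mul_pow, ← zpow_natCast, ← zpow_mul]
  simp [mul_comm n 2, zpow_mul]

lemma abscissa_pos_of_mem_Ioo (h0 : 1 / 2 < m) (hm : m < 1) (h : 2 * retreat m < advance m)
    {u : ℝ} (hu : u ∈ Ioo 0 π) : 0 < abscissa m u := by
  have hr := retreat_pos h0 hm
  rcases lt_or_ge u (π / 2) with h' | h'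
  · exact abscissa_pos h0 hm (by linarith) ⟨hu.1, h'⟩
  · linarith [(abscissa_ge h0 hm ⟨h', hu.2.le⟩).1]

/-- Below the first threshold the abscissa only takes multiples of its half-period increment at
multiples of the half period. -/
lemma abscissa_ne_int_mul (h0 : 1 / 2 < m) (hm : m < 1) (h : 2 * retreat m < advance m)
    {φ : ℝ} {n : ℤ} (hφ : abscissa m φ = n * abscissa m π) : φ = n * π := by
  obtain ⟨u, hu, k, rfl⟩ := exists_eq_add_int_mul_pi φ
  rw [abscissa_add_int_mul_pi hm] at hφ
  have hr := retreat_pos h0 hm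
  have hP : 0 < abscissa m π := by rw [abscissa_pi hm]; linarith
  rcases hu.1.lt_or_eq with h' | h'
  · have h1 := abscissa_pos_of_mem_Ioo h0 hm h ⟨h', hu.2⟩
    have h2 := abscissa_pos_of_mem_Ioo h0 hm h (u := π - u) ⟨by linarith [hu.2], by linarith⟩
    rw [abscissa_pi_sub hm] at h2
    -- Positivity at u and at π - u squeezes the integer n - k strictly between 0 and 1.
    have e : abscissa m u = (n - k : ℤ) * abscissa m π := by push_cast; linarith
    rw [e] at h1 h2
    have h3 : (0 : ℝ) < (n - k : ℤ) := pos_of_mul_pos_left h1 hP.le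
    have h4 : ((n - k : ℤ) : ℝ) < 1 := by
      by_contra! hc
      nlinarith
    norm_cast at h3 h4
    omega
  · rw [← h', abscissa_zero, zero_add] at hφ
    have := mul_right_cancel₀ hP.ne' hφ
    rw [← h', this, zero_add]

/-- At the first threshold the abscissa is nonnegative on a half period and takes multiples of its
increment only at multiples of the half period and at critical points. -/
lemma abscissa_nonneg_of_eq (h0 : 1 / 2 < m) (hm : m < 1) (h : 2 * retreat m = advance m)
    {u : ℝ} (hu : u ∈ Icc 0 π) :
    0 ≤ abscissa m u ∧ (abscissa m u = 0 → u = 0 ∨ u = π - turning m) := by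
  have hr := retreat_pos h0 hm
  rcases hu.1.eq_or_lt with h1 | h1
  · exact ⟨by rw [← h1, abscissa_zero], fun _ => Or.inl h1.symm⟩
  rcases lt_or_ge u (π / 2) with h' | h'
  · have := abscissa_pos h0 hm (by linarith) ⟨h1, h'⟩
    exact ⟨this.le, fun e => absurd e this.ne'⟩
  · have := abscissa_ge h0 hm ⟨h', hu.2⟩
    rw [h, sub_self] at this
    exact ⟨this.1, fun e => Or.inr (this.2 e)⟩

lemma abscissa_eq_int_mul_of_eq (h0 : 1 / 2 < m) (hm : m < 1) (h : 2 * retreat m = advance m)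
    {φ : ℝ} {n : ℤ} (hφ : abscissa m φ = n * abscissa m π) :
    φ = n * π ∨ m * sin φ ^ 2 = 1 / 2 := by
  obtain ⟨u, hu, k, rfl⟩ := exists_eq_add_int_mul_pi φ
  rw [abscissa_add_int_mul_pi hm] at hφ
  rw [sin_add_int_mul_pi_sq]
  have hr := retreat_pos h0 hm
  have hP : 0 < abscissa m π := by rw [abscissa_pi hm]; linarith
  have hs := mul_sin_turning_sq h0
  have e : abscissa m u = (n - k : ℤ) * abscissa m π := by push_cast; linarith
  have h1 := abscissa_nonneg_of_eq h0 hm h ⟨hu.1, hu.2.le⟩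
  have h2 := abscissa_nonneg_of_eq h0 hm h (u := π - u) ⟨by linarith [hu.2], by linarith [hu.1]⟩
  rw [abscissa_pi_sub hm] at h2
  have h3 : (0 : ℝ) ≤ (n - k : ℤ) := by
    by_contra! hc
    nlinarith [h1.1]
  have h4 : ((n - k : ℤ) : ℝ) ≤ 1 := by
    by_contra! hc
    nlinarith [h2.1]
  norm_cast at h3 h4
  obtain h5 | h5 : n - k = 0 ∨ n - k = 1 := by omega
  · rw [h5] at e
    rcases h1.2 (by simpa using e) with h6 | h6
    · left
      rw [h6, zero_add, show n = k by omega]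
    · right
      rwa [h6, sin_pi_sub]
  · rw [h5] at e
    rcases h2.2 (by rw [e]; simp) with h6 | h6
    · linarith [hu.2]
    · right
      rwa [show u = turning m by linarith]

/-- A critical point at which the abscissa is a multiple of its half-period increment makes the
advance an even multiple of the quarter-period increment. -/
lemma exists_resonance (h0 : 1 / 2 < m) (hm : m < 1) {φ : ℝ} {n : ℤ}
    (hφ : abscissa m φ = n * abscissa m π) (hc : m * sin φ ^ 2 = 1 / 2) :
    ∃ j : ℤ, advance m = 2 * j * (advance m - retreat m) := by
  obtain ⟨u, hu, k, rfl⟩ := exists_eq_add_int_mul_pi φ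
  rw [abscissa_add_int_mul_pi hm, abscissa_pi hm] at hφ
  rw [sin_add_int_mul_pi_sq] at hc
  rcases abscissa_critical h0 hm ⟨hu.1, hu.2.le⟩ hc with h | h
  · exact ⟨n - k, by push_cast; linarith⟩
  · exact ⟨1 - (n - k), by push_cast; linarith⟩

/-- Within one period, a double point at a critical point only occurs at the first threshold. -/
lemma two_retreat_eq_of_abscissa_eq_zero (h0 : 1 / 2 < m) (hm : m < 1) {u : ℝ}
    (hu : u ∈ Ioo (-π) π) (h : abscissa m u = 0) (hc : m * sin u ^ 2 = 1 / 2) :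
    2 * retreat m = advance m := by
  have hp := advance_pos hm
  have key : ∀ u ∈ Icc 0 π, abscissa m u = 0 → m * sin u ^ 2 = 1 / 2 →
      2 * retreat m = advance m := by
    intro u hu h hc
    -- The critical value A is positive, so a vanishing one must be A - 2R.
    rcases abscissa_critical h0 hm hu hc with h | h <;> linarith
  rcases le_total 0 u with h' | h'
  · exact key u ⟨h', hu.2.le⟩ h hc
  · exact key (-u) ⟨by linarith, by linarith [hu.1]⟩ (by rw [abscissa_neg, h, neg_zero])
      (by rwa [sin_neg, neg_sq])

/-- Beyond the first threshold the abscissa vanishes inside a half period. -/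
lemma exists_abscissa_eq_zero (h0 : 1 / 2 < m) (hm : m < 1) (h : advance m ≤ 2 * retreat m) :
    ∃ u ∈ Ioo 0 π, abscissa m u = 0 := by
  have h1 := turning_pos h0
  have h2 := turning_lt h0
  have hp := advance_pos hm
  -- The abscissa passes from its maximum A > 0 to its minimum A - 2R ≤ 0.
  obtain ⟨u, hu, e⟩ := intermediate_value_Icc' (show turning m ≤ π - turning m by linarith)
    (continuous_abscissa hm).continuousOn
    (show (0 : ℝ) ∈ Icc (abscissa m (π - turning m)) (abscissa m (turning m)) by
      rw [abscissa_turning h0 hm, abscissa_pi_sub_turning h0 hm]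
      constructor <;> linarith)
  exact ⟨u, ⟨by linarith [hu.1], by linarith [hu.2]⟩, e⟩

/-- At the second threshold the abscissa vanishes exactly at the quarter periods. -/
lemma eq_pi_div_two_of_abscissa_eq_zero (h0 : 1 / 2 < m) (hm : m < 1)
    (h : retreat m = advance m) {u : ℝ} (hu : u ∈ Ioo 0 π) (hz : abscissa m u = 0) :
    u = π / 2 := by
  rcases lt_trichotomy u (π / 2) with h' | h' | h'
  · exact absurd hz (abscissa_pos h0 hm h.le ⟨hu.1, h'⟩).ne'
  · exact h'
  · have := abscissa_pos h0 hm h.le (t := π - u) ⟨by linarith [hu.2], by linarith⟩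
    rw [abscissa_pi_sub hm, abscissa_pi hm, hz, h] at this
    simp at this

end Turning

/-! ### From mean curvature to the differential system -/

section Cylinder

variable {x z : ℝ → ℝ}

lemma hasDerivAt_vec3 {a b c : ℝ → ℝ} {a' b' c' t : ℝ} (ha : HasDerivAt a a' t)
    (hb : HasDerivAt b b' t) (hc : HasDerivAt c c' t) :
    HasDerivAt (fun s => ![a s, b s, c s]) ![a', b', c'] t := by
  rw [hasDerivAt_pi]
  intro i
  fin_cases i
  · exact ha
  · exact hb
  · exact hc

lemma partialS_cylinder (hx : Differentiable ℝ x) (hz : Differentiable ℝ z) :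
    partialS (cylinder x z) = fun s _ => ![deriv x s, 0, deriv z s] := by
  funext s t
  exact (hasDerivAt_vec3 (hx s).hasDerivAt (hasDerivAt_const s t) (hz s).hasDerivAt).deriv

lemma partialT_cylinder : partialT (cylinder x z) = fun _ _ => ![0, 1, 0] := by
  funext s t
  exact (hasDerivAt_vec3 (hasDerivAt_const t (x s)) (hasDerivAt_id t)
    (hasDerivAt_const t (z s))).deriv

/-- Twice the mean curvature of a cylinder over a curve of unit speed is the signed curvature of
the curve. -/
lemma two_mul_meanCurvature_cylinder (hx : ContDiff ℝ 2 x) (hz : ContDiff ℝ 2 z)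
    (hu : ∀ s, deriv x s ^ 2 + deriv z s ^ 2 = 1) (s t : ℝ) :
    2 * meanCurvature (cylinder x z) s t =
      deriv x s * deriv (deriv z) s - deriv z s * deriv (deriv x) s := by
  have hx1 : Differentiable ℝ x := hx.differentiable (by norm_num)
  have hz1 : Differentiable ℝ z := hz.differentiable (by norm_num)
  have hx2 : Differentiable ℝ (deriv x) := hx.differentiable_deriv_two
  have hz2 : Differentiable ℝ (deriv z) := hz.differentiable_deriv_two
  have hS := partialS_cylinder hx1 hz1
  have hT := partialT_cylinder (x := x) (z := z)
  have hSS : partialS (partialS (cylinder x z)) s t =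
      ![deriv (deriv x) s, 0, deriv (deriv z) s] := by
    rw [hS]
    exact (hasDerivAt_vec3 (hx2 s).hasDerivAt (hasDerivAt_const s 0) (hz2 s).hasDerivAt).deriv
  have hTT : partialT (partialT (cylinder x z)) s t = 0 := by
    rw [hT]; exact deriv_const _ _
  have hN : unitNormal (cylinder x z) s t = ![-deriv z s, 0, deriv x s] := by
    simp only [unitNormal, hS, hT, cross_apply]
    have h := hu s
    simp [Fin.sum_univ_three, dotProduct, ← sq]
    rw [add_comm, h]; simp
  simp only [meanCurvature, hSS, hTT, hN]
  rw [hS, hT]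
  have h := hu s
  simp [Fin.sum_univ_three, dotProduct, ← sq, h]
  ring

end Cylinder

/-- The system satisfied by a directrix `(x, z)`, written with `p = x'` and `q = z'`. -/
lemma IsDirectrix.hasDerivAt {κ z₀ : ℝ} {x z : ℝ → ℝ} (h : IsDirectrix κ z₀ x z) (s : ℝ) :
    HasDerivAt x (deriv x s) s ∧ HasDerivAt z (deriv z s) s ∧
    HasDerivAt (deriv x) (-(κ * z s * deriv z s)) s ∧
    HasDerivAt (deriv z) (κ * z s * deriv x s) s := by
  have hx2 := h.contDiff_x.differentiable_deriv_two
  have hz2 := h.contDiff_z.differentiable_deriv_two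
  have hu := h.unit_speed s
  have hc := h.capillary s 0
  rw [two_mul_meanCurvature_cylinder h.contDiff_x h.contDiff_z h.unit_speed] at hc
  have hc' : deriv x s * deriv (deriv z) s - deriv z s * deriv (deriv x) s = κ * z s := hc
  -- Differentiated unit speed and the curvature equation form a linear system for (x'', z'') with
  -- determinant 1.
  have h0 : deriv x s * deriv (deriv x) s + deriv z s * deriv (deriv z) s = 0 := by
    have h1 : HasDerivAt (fun s => deriv x s ^ 2 + deriv z s ^ 2) _ s :=
      ((hx2 s).hasDerivAt.pow 2).add ((hz2 s).hasDerivAt.pow 2)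
    have h2 : HasDerivAt (fun s => deriv x s ^ 2 + deriv z s ^ 2) 0 s := by
      simp only [h.unit_speed]; exact hasDerivAt_const s 1
    have := h1.unique h2
    simp at this
    linarith
  refine ⟨(h.contDiff_x.differentiable (by norm_num) s).hasDerivAt,
    (h.contDiff_z.differentiable (by norm_num) s).hasDerivAt, ?_, ?_⟩
  · exact (hx2 s).hasDerivAt.congr_deriv (by
      linear_combination (-deriv z s) * hc' + deriv x s * h0 - deriv (deriv x) s * hu)
  · exact (hz2 s).hasDerivAt.congr_deriv (by
      linear_combination deriv x s * hc' + deriv z s * h0 - deriv (deriv z) s * hu)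

/-! ### Uniqueness and the amplitude parametrization -/

/-- A nonnegative function vanishing at `0` whose derivative it dominates vanishes identically. -/
lemma eq_zero_of_abs_deriv_le {u u' : ℝ → ℝ} {C : ℝ} (hu : ∀ t, HasDerivAt u (u' t) t)
    (h0 : u 0 = 0) (hnn : ∀ t, 0 ≤ u t) (hle : ∀ t, |u' t| ≤ C * u t) (t : ℝ) : u t = 0 := by
  have hE : ∀ a t : ℝ, HasDerivAt (fun t => u t * exp (a * t))
      (u' t * exp (a * t) + u t * (exp (a * t) * a)) t := fun a t =>
    (hu t).mul (by simpa using ((hasDerivAt_id t).const_mul a).exp)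
  rcases le_total 0 t with ht | ht
  · have hanti : Antitone fun t => u t * exp (-C * t) := by
      refine antitone_of_deriv_nonpos (fun t => (hE _ t).differentiableAt) fun t => ?_
      rw [(hE _ t).deriv]
      have := (abs_le.1 (hle t)).2
      nlinarith [exp_pos (-C * t)]
    have := hanti ht
    simp only [h0, zero_mul] at this
    exact le_antisymm (nonpos_of_mul_nonpos_left this (exp_pos _)) (hnn t)
  · have hmono : Monotone fun t => u t * exp (C * t) := by
      refine monotone_of_deriv_nonneg (fun t => (hE _ t).differentiableAt) fun t => ?_
      rw [(hE _ t).deriv]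
      have := (abs_le.1 (hle t)).1
      nlinarith [exp_pos (C * t)]
    have := hmono ht
    simp only [h0, zero_mul] at this
    exact le_antisymm (nonpos_of_mul_nonpos_left this (exp_pos _)) (hnn t)

/-- Uniqueness for the system `z' = w q`, `p' = c² w z q`, `q' = -c² w z p`. -/
lemma eq_of_elastica_system {c W : ℝ} {w z p q Z P Q : ℝ → ℝ}
    (hw : ∀ t, |w t| ≤ W) (hpq : ∀ t, p t ^ 2 + q t ^ 2 = 1)
    (hz : ∀ t, HasDerivAt z (w t * q t) t) (hp : ∀ t, HasDerivAt p (c ^ 2 * w t * z t * q t) t)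
    (hq : ∀ t, HasDerivAt q (-(c ^ 2 * w t * z t * p t)) t)
    (hZ : ∀ t, HasDerivAt Z (w t * Q t) t) (hP : ∀ t, HasDerivAt P (c ^ 2 * w t * Z t * Q t) t)
    (hQ : ∀ t, HasDerivAt Q (-(c ^ 2 * w t * Z t * P t)) t)
    (hz0 : z 0 = Z 0) (hp0 : p 0 = P 0) (hq0 : q 0 = Q 0) (t : ℝ) :
    z t = Z t ∧ p t = P t ∧ q t = Q t := by
  -- In the derivative of the squared distance the terms carrying Z cancel, so only |p|, |q| ≤ 1 and
  -- the bound on w are needed.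
  have hu : ∀ t, HasDerivAt (fun t => (z t - Z t) ^ 2 + (p t - P t) ^ 2 + (q t - Q t) ^ 2)
      (2 * w t * ((z t - Z t) * (q t - Q t) + c ^ 2 * (z t - Z t) * (p t - P t) * q t
        - c ^ 2 * (z t - Z t) * (q t - Q t) * p t)) t := by
    intro t
    have := ((((hz t).sub (hZ t)).pow 2).add (((hp t).sub (hP t)).pow 2)).add
      (((hq t).sub (hQ t)).pow 2)
    refine this.congr_deriv ?_
    simp
    ring
  have hbound : ∀ t, |2 * w t * ((z t - Z t) * (q t - Q t) + c ^ 2 * (z t - Z t) * (p t - P t) * q t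
        - c ^ 2 * (z t - Z t) * (q t - Q t) * p t)| ≤
      (W * (1 + 2 * c ^ 2)) * ((z t - Z t) ^ 2 + (p t - P t) ^ 2 + (q t - Q t) ^ 2) := by
    intro t
    have hp1 : |p t| ≤ 1 := abs_le_one_iff_mul_self_le_one.2 (by nlinarith [hpq t, sq_nonneg (q t)])
    have hq1 : |q t| ≤ 1 := abs_le_one_iff_mul_self_le_one.2 (by nlinarith [hpq t, sq_nonneg (p t)])
    generalize z t - Z t = a, p t - P t = b, q t - Q t = e
    have h1 : 2 * |a * e + c ^ 2 * a * b * q t - c ^ 2 * a * e * p t| ≤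
        (1 + 2 * c ^ 2) * (a ^ 2 + b ^ 2 + e ^ 2) := by
      have t1 : |a * e| = |a| * |e| := abs_mul _ _
      have t2 : |c ^ 2 * a * b * q t| ≤ c ^ 2 * (|a| * |b|) := by
        rw [abs_mul, abs_mul, abs_mul, abs_of_nonneg (sq_nonneg c), mul_assoc (c ^ 2)]
        exact mul_le_of_le_one_right (by positivity) hq1
      have t3 : |c ^ 2 * a * e * p t| ≤ c ^ 2 * (|a| * |e|) := by
        rw [abs_mul, abs_mul, abs_mul, abs_of_nonneg (sq_nonneg c), mul_assoc (c ^ 2)]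
        exact mul_le_of_le_one_right (by positivity) hp1
      have t4 := abs_sub (a * e + c ^ 2 * a * b * q t) (c ^ 2 * a * e * p t)
      have t5 := abs_add_le (a * e) (c ^ 2 * a * b * q t)
      have t6 : 2 * (|a| * |e|) ≤ a ^ 2 + b ^ 2 + e ^ 2 := by
        nlinarith [sq_nonneg (|a| - |e|), sq_abs a, sq_abs e, sq_nonneg b]
      have t7 : 2 * (|a| * |b|) ≤ a ^ 2 + b ^ 2 + e ^ 2 := by
        nlinarith [sq_nonneg (|a| - |b|), sq_abs a, sq_abs b, sq_nonneg e]
      have t8 := mul_le_mul_of_nonneg_left t6 (sq_nonneg c)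
      have t9 := mul_le_mul_of_nonneg_left t7 (sq_nonneg c)
      linarith
    rw [mul_comm 2 (w t), mul_assoc (w t), abs_mul, abs_mul 2, abs_two, mul_assoc W]
    exact mul_le_mul (hw t) h1 (by positivity) ((abs_nonneg _).trans (hw t))
  have := eq_zero_of_abs_deriv_le hu (by simp [hz0, hp0, hq0]) (fun t => by positivity) hbound t
  have ha := sq_nonneg (z t - Z t)
  have hb := sq_nonneg (p t - P t)
  have he := sq_nonneg (q t - Q t)
  refine ⟨?_, ?_, ?_⟩ <;> refine sub_eq_zero.1 (pow_eq_zero_iff two_ne_zero |>.1 ?_) <;> linarith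

/-- The elastica of parameter `m` parametrized by its amplitude: `s = F(φ) / c`. -/
lemma IsDirectrix.amplitude {c m : ℝ} {x z : ℝ → ℝ} (hc : 0 < c) (hm0 : 0 ≤ m) (hm : m < 1)
    (h : IsDirectrix (-c ^ 2) (-(2 * √m / c)) x z) (φ : ℝ) :
    x (ellipticF m φ / c) = abscissa m φ / c ∧
    z (ellipticF m φ / c) = -(2 * √m / c) * cos φ ∧
    deriv x (ellipticF m φ / c) = 1 - 2 * (m * sin φ ^ 2) ∧
    deriv z (ellipticF m φ / c) = 2 * √m * sin φ * √(1 - m * sin φ ^ 2) := by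
  have hΔ : ∀ t, 0 < √(1 - m * sin t ^ 2) :=
    fun t => Real.sqrt_pos.2 (one_sub_mul_sin_sq_pos hm t)
  have hΔ2 : ∀ t, √(1 - m * sin t ^ 2) ^ 2 = 1 - m * sin t ^ 2 :=
    fun t => Real.sq_sqrt (one_sub_mul_sin_sq_pos hm t).le
  have hm2 : √m ^ 2 = m := Real.sq_sqrt hm0
  have hS : ∀ t, HasDerivAt (fun t => ellipticF m t / c) ((√(1 - m * sin t ^ 2))⁻¹ / c) t :=
    fun t => (hasDerivAt_ellipticF hm t).div_const c
  have hsq : ∀ t, HasDerivAt (fun t => m * sin t ^ 2) (2 * m * sin t * cos t) t := fun t =>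
    (((hasDerivAt_sin t).pow 2).const_mul m).congr_deriv (by simp; ring)
  have hbound : ∀ t, |(√(1 - m * sin t ^ 2))⁻¹ / c| ≤ (√(1 - m))⁻¹ / c := by
    intro t
    have := hΔ t
    rw [abs_of_pos (by positivity)]
    have h1 : √(1 - m) ≤ √(1 - m * sin t ^ 2) :=
      Real.sqrt_le_sqrt (by nlinarith [sin_sq_le_one t])
    have h2 : 0 < √(1 - m) := Real.sqrt_pos.2 (by linarith)
    gcongr
  -- The factor w is ds/dφ; Z, P, Q are the explicit height, cos θ and sin θ obtained from sin(θ/2)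
  -- = √m sin φ.
  have key := eq_of_elastica_system (c := c) (w := fun t => (√(1 - m * sin t ^ 2))⁻¹ / c)
    (z := fun t => z (ellipticF m t / c)) (p := fun t => deriv x (ellipticF m t / c))
    (q := fun t => deriv z (ellipticF m t / c)) (Z := fun t => -(2 * √m / c) * cos t)
    (P := fun t => 1 - 2 * (m * sin t ^ 2))
    (Q := fun t => 2 * √m * sin t * √(1 - m * sin t ^ 2)) hbound
    (fun t => h.unit_speed _)
    (fun t => ((h.hasDerivAt _).2.1.comp t (hS t)).congr_deriv (by ring))
    (fun t => ((h.hasDerivAt _).2.2.1.comp t (hS t)).congr_deriv (by ring))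
    (fun t => ((h.hasDerivAt _).2.2.2.comp t (hS t)).congr_deriv (by ring))
    (fun t => ((hasDerivAt_cos t).const_mul _).congr_deriv (by
      have := (hΔ t).ne'
      generalize √(1 - m * sin t ^ 2) = Δ at this ⊢
      field_simp))
    (fun t => (((hsq t).const_mul 2).const_sub 1).congr_deriv (by
      have := (hΔ t).ne'
      field_simp
      rw [hm2]; ring))
    (fun t => ((((hasDerivAt_sin t).const_mul (2 * √m)).mul
      (((hsq t).const_sub 1).sqrt (one_sub_mul_sin_sq_pos hm t).ne'))).congr_deriv (by
      have := (hΔ t).ne'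
      have h2 := hΔ2 t
      field_simp
      rw [h2]; ring))
    (by simp [ellipticF_zero, h.z_zero]) (by simp [ellipticF_zero, h.velocity_x_zero])
    (by simp [ellipticF_zero, h.velocity_z_zero])
  refine ⟨?_, key φ⟩
  have hx : ∀ t, HasDerivAt (fun t => x (ellipticF m t / c) - abscissa m t / c) 0 t := by
    intro t
    refine (((h.hasDerivAt _).1.comp t (hS t)).sub
      ((hasDerivAt_abscissa hm t).div_const c)).congr_deriv ?_
    rw [(key t).2.1, abscissaRate]
    ring
  have := is_const_of_deriv_eq_zero (fun t => (hx t).differentiableAt) (fun t => (hx t).deriv) φ 0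
  simp only [ellipticF_zero, zero_div, h.x_zero, abscissa_zero] at this
  linarith

/-- A continuous function growing by a positive amount over each period tends to infinity. -/
lemma tendsto_atTop_of_add_period {f : ℝ → ℝ} {T d : ℝ} (hf : Continuous f) (hT : 0 < T)
    (hd : 0 < d) (h : ∀ s, f (s + T) = f s + d) : Tendsto f atTop atTop := by
  -- Removing the linear trend leaves a continuous periodic function, which is bounded below.
  have hper : Periodic (fun s => f s - d / T * s) T := fun s => by
    simp only [h]; field_simp; ring
  obtain ⟨C, hC⟩ := (isCompact_Icc (a := (0 : ℝ)) (b := T)).bddBelow_image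
    (f := fun s => f s - d / T * s) (by fun_prop)
  have hlow : ∀ s, C + d / T * s ≤ f s := by
    intro s
    obtain ⟨t, ht, e⟩ := hper.exists_mem_Ico₀ hT s
    have := hC ⟨t, Ico_subset_Icc_self ht, e.symm⟩
    linarith
  exact tendsto_atTop_mono hlow
    (tendsto_atTop_add_const_left _ _ (tendsto_id.const_mul_atTop (by positivity)))

/-! ### Double points and drift of the directrix -/

namespace IsDirectrix

variable {c m : ℝ} {x z : ℝ → ℝ}

lemma exists_amplitude (hc : 0 < c) (hm : m < 1) (s : ℝ) : ∃ φ, s = ellipticF m φ / c := by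
  obtain ⟨φ, hφ⟩ := ellipticF_surjective hm (s * c)
  exact ⟨φ, by rw [hφ]; field_simp⟩

lemma amplitude_injective (hc : 0 < c) (hm : m < 1) {φ ψ : ℝ} :
    ellipticF m φ / c = ellipticF m ψ / c ↔ φ = ψ := by
  rw [div_left_inj' hc.ne', (ellipticF_strictMono hm).injective.eq_iff]

lemma amplitude_add_period (hm : m < 1) (φ : ℝ) :
    ellipticF m φ / c + 2 * ellipticF m π / c = ellipticF m (φ + (2 : ℤ) * π) / c := by
  rw [ellipticF_add_int_mul_pi hm]; push_cast; ring

/-- Double points in terms of the amplitudes. -/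
lemma meets_iff (hc : 0 < c) (hm0 : 1 / 2 < m) (hm : m < 1)
    (h : IsDirectrix (-c ^ 2) (-(2 * √m / c)) x z) (φ ψ : ℝ) :
    Meets x z (ellipticF m φ / c) (ellipticF m ψ / c) ↔
      φ ≠ ψ ∧ abscissa m φ = abscissa m ψ ∧ cos φ = cos ψ := by
  have h1 := h.amplitude hc (by linarith) hm
  have hs : 0 < √m := Real.sqrt_pos.2 (by linarith)
  have hne : -(2 * √m / c) ≠ 0 := neg_ne_zero.2 (by positivity)
  rw [Meets, (h1 φ).1, (h1 ψ).1, (h1 φ).2.1, (h1 ψ).2.1, ne_eq, amplitude_injective hc hm,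
    div_left_inj' hc.ne', mul_right_inj' hne]

/-- The ordinate has least period `2 F(π) / c`. -/
lemma isLeastPeriod (hc : 0 < c) (hm0 : 1 / 2 < m) (hm : m < 1)
    (h : IsDirectrix (-c ^ 2) (-(2 * √m / c)) x z) :
    IsLeastPeriod z (2 * ellipticF m π / c) := by
  have h1 := h.amplitude hc (by linarith) hm
  have hp := ellipticF_pi_pos hm
  have hs : 0 < √m := Real.sqrt_pos.2 (by linarith)
  have hne : -(2 * √m / c) ≠ 0 := neg_ne_zero.2 (by positivity)
  refine ⟨⟨by positivity, fun s => ?_⟩, ?_⟩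
  · obtain ⟨φ, rfl⟩ := exists_amplitude hc hm s
    rw [amplitude_add_period hm, (h1 _).2.1, (h1 _).2.1]
    push_cast
    rw [cos_add_two_pi]
  · rintro T ⟨hT, hper⟩
    obtain ⟨φ, rfl⟩ := exists_amplitude hc hm T
    have h2 := hper 0
    rw [zero_add, h.z_zero, (h1 φ).2.1] at h2
    -- A period returns z to its initial value, which is attained only at amplitudes in 2πℤ.
    have h3 : cos φ = 1 := by
      refine mul_left_cancel₀ hne ?_
      rw [h2, mul_one]
    obtain ⟨n, hn⟩ := (cos_eq_one_iff φ).1 h3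
    have hφ : 0 < φ := by
      rw [← (ellipticF_strictMono hm).lt_iff_lt, ellipticF_zero]
      exact (div_pos_iff_of_pos_right hc).1 hT
    have hn1 : (1 : ℝ) ≤ n := by
      have : (0 : ℝ) < n := by
        by_contra! hc
        nlinarith [pi_pos]
      exact_mod_cast this
    have h4 : ellipticF m (0 + (2 : ℤ) * π) ≤ ellipticF m φ := by
      refine (ellipticF_strictMono hm).monotone ?_
      rw [← hn]; push_cast; nlinarith [pi_pos]
    rw [ellipticF_add_int_mul_pi hm, ellipticF_zero] at h4
    push_cast at h4
    gcongr
    linarith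

lemma x_period (hc : 0 < c) (hm0 : 1 / 2 < m) (hm : m < 1)
    (h : IsDirectrix (-c ^ 2) (-(2 * √m / c)) x z) :
    x (2 * ellipticF m π / c) = 4 * (advance m - retreat m) / c := by
  have h1 := (h.amplitude hc (by linarith) hm (0 + (2 : ℤ) * π)).1
  rw [← amplitude_add_period hm, ellipticF_zero, zero_div, zero_add] at h1
  rw [h1, abscissa_add_int_mul_pi hm, abscissa_zero, abscissa_pi hm]
  push_cast; ring

lemma x_add_period (hc : 0 < c) (hm0 : 1 / 2 < m) (hm : m < 1)
    (h : IsDirectrix (-c ^ 2) (-(2 * √m / c)) x z) (s : ℝ) :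
    x (s + 2 * ellipticF m π / c) = x s + x (2 * ellipticF m π / c) := by
  have h1 := h.amplitude hc (by linarith) hm
  obtain ⟨φ, rfl⟩ := exists_amplitude hc hm s
  rw [h.x_period hc hm0 hm, amplitude_add_period hm, (h1 _).1, (h1 _).1,
    abscissa_add_int_mul_pi hm, abscissa_pi hm]
  push_cast; ring

lemma tendsto_atTop (hc : 0 < c) (hm0 : 1 / 2 < m) (hm : m < 1)
    (h : IsDirectrix (-c ^ 2) (-(2 * √m / c)) x z) (hlt : retreat m < advance m) :
    Tendsto x atTop atTop := by
  refine tendsto_atTop_of_add_period h.contDiff_x.continuous (h.isLeastPeriod hc hm0 hm).1.1 ?_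
    (h.x_add_period hc hm0 hm)
  rw [h.x_period hc hm0 hm]
  have := sub_pos.2 hlt
  positivity

lemma tendsto_atBot (hc : 0 < c) (hm0 : 1 / 2 < m) (hm : m < 1)
    (h : IsDirectrix (-c ^ 2) (-(2 * √m / c)) x z) (hlt : advance m < retreat m) :
    Tendsto x atTop atBot := by
  rw [← tendsto_neg_atTop_iff]
  refine tendsto_atTop_of_add_period (T := 2 * ellipticF m π / c)
    (d := -x (2 * ellipticF m π / c)) h.contDiff_x.continuous.neg
    (h.isLeastPeriod hc hm0 hm).1.1 ?_ fun s => ?_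
  · rw [h.x_period hc hm0 hm]
    have := sub_pos.2 hlt
    have e : -(4 * (advance m - retreat m) / c) = 4 * (retreat m - advance m) / c := by ring
    rw [e]; positivity
  · rw [h.x_add_period hc hm0 hm, neg_add]

/-- If the curve is not closed, then a double point joins an ascending and a descending branch
that are mirror images of each other. -/
lemma exists_of_meets (hc : 0 < c) (hm0 : 1 / 2 < m) (hm : m < 1)
    (h : IsDirectrix (-c ^ 2) (-(2 * √m / c)) x z) (hne : advance m ≠ retreat m) {s t : ℝ}
    (hst : Meets x z s t) :
    ∃ (φ : ℝ) (n : ℤ), s = ellipticF m φ / c ∧ t = ellipticF m (-φ + (2 * n : ℤ) * π) / c ∧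
      φ ≠ n * π ∧ abscissa m φ = n * abscissa m π := by
  obtain ⟨φ, rfl⟩ := exists_amplitude hc hm s
  obtain ⟨ψ, rfl⟩ := exists_amplitude hc hm t
  obtain ⟨h1, h2, h3⟩ := (h.meets_iff hc hm0 hm φ ψ).1 hst
  obtain ⟨n, hn | hn⟩ := cos_eq_cos_iff.1 h3
  -- Points whole periods apart differ in abscissa by a multiple of A - R ≠ 0.
  · have e : ψ = φ + (2 * n : ℤ) * π := by rw [hn]; push_cast; ring
    rw [e, abscissa_add_int_mul_pi hm, abscissa_pi hm] at h2
    have hn0 : (n : ℝ) ≠ 0 := by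
      rintro h0
      rw [h0] at hn
      exact h1 (by linarith)
    have h4 : (n : ℝ) * (advance m - retreat m) = 0 := by push_cast at h2; linarith
    exact absurd (sub_eq_zero.1 ((mul_eq_zero.1 h4).resolve_left hn0)) hne
  · have e : ψ = -φ + (2 * n : ℤ) * π := by rw [hn]; push_cast; ring
    refine ⟨φ, n, rfl, by rw [e], fun h0 => h1 (by linarith), ?_⟩
    rw [e, abscissa_add_int_mul_pi hm, abscissa_neg] at h2
    push_cast at h2
    linarith

/-- Mirror branches have parallel tangents exactly where these are vertical or horizontal. -/
lemma parallelTangents_iff (hc : 0 < c) (hm0 : 1 / 2 < m) (hm : m < 1)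
    (h : IsDirectrix (-c ^ 2) (-(2 * √m / c)) x z) (φ : ℝ) (n : ℤ) :
    ParallelTangents x z (ellipticF m φ / c) (ellipticF m (-φ + (2 * n : ℤ) * π) / c) ↔
      m * sin φ ^ 2 = 1 / 2 ∨ sin φ = 0 := by
  have h1 := h.amplitude hc (by linarith) hm
  have hs : 0 < √m := Real.sqrt_pos.2 (by linarith)
  have hΔ := Real.sqrt_pos.2 (one_sub_mul_sin_sq_pos hm φ)
  have e : sin (-φ + (2 * n : ℤ) * π) = -sin φ := by
    rw [← sin_neg, ← sin_add_int_mul_two_pi (-φ) n]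
    push_cast
    ring_nf
  rw [ParallelTangents, (h1 φ).2.2.1, (h1 φ).2.2.2, (h1 _).2.2.1, (h1 _).2.2.2, e, neg_sq]
  -- The determinant of two mirrored velocities is -2x'z'.
  have e2 : (1 - 2 * (m * sin φ ^ 2)) * (2 * √m * -sin φ * √(1 - m * sin φ ^ 2)) -
      2 * √m * sin φ * √(1 - m * sin φ ^ 2) * (1 - 2 * (m * sin φ ^ 2)) =
      (-(4 * √m * √(1 - m * sin φ ^ 2))) * ((1 - 2 * (m * sin φ ^ 2)) * sin φ) := by ring
  rw [e2, mul_eq_zero, mul_eq_zero, or_iff_right (neg_ne_zero.2 (by positivity))]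
  refine or_congr_left ⟨fun h => by linarith, fun h => by linarith⟩

/-- At a double point of a curve that is not closed, parallel tangents are vertical. -/
lemma mul_sin_sq_eq_half (hm : m < 1) (hne : advance m ≠ retreat m) {φ : ℝ} {n : ℤ}
    (hφ : φ ≠ n * π) (ha : abscissa m φ = n * abscissa m π)
    (h : m * sin φ ^ 2 = 1 / 2 ∨ sin φ = 0) : m * sin φ ^ 2 = 1 / 2 := by
  refine h.resolve_right fun h0 => hφ ?_
  obtain ⟨k, rfl⟩ := sin_eq_zero_iff.1 h0
  have h2 := abscissa_add_int_mul_pi hm 0 k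
  rw [zero_add, abscissa_zero, zero_add, ha] at h2
  have hP : abscissa m π ≠ 0 := by
    rw [abscissa_pi hm]
    exact mul_ne_zero two_ne_zero (sub_ne_zero.2 hne)
  rw [mul_right_cancel₀ hP h2]

lemma not_meets (hc : 0 < c) (hm0 : 1 / 2 < m) (hm : m < 1)
    (h : IsDirectrix (-c ^ 2) (-(2 * √m / c)) x z) (hlt : 2 * retreat m < advance m) (s t : ℝ) :
    ¬ Meets x z s t := by
  intro hst
  have := retreat_pos hm0 hm
  obtain ⟨φ, n, -, -, h1, h2⟩ := h.exists_of_meets hc hm0 hm (by linarith) hst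
  exact h1 (abscissa_ne_int_mul hm0 hm hlt h2)

/-- Beyond the first threshold there is a double point within one period. -/
lemma exists_meets (hc : 0 < c) (hm0 : 1 / 2 < m) (hm : m < 1)
    (h : IsDirectrix (-c ^ 2) (-(2 * √m / c)) x z) (hle : advance m ≤ 2 * retreat m) :
    ∃ s t, |s - t| < 2 * ellipticF m π / c ∧ Meets x z s t := by
  obtain ⟨u, hu, hz⟩ := exists_abscissa_eq_zero hm0 hm hle
  -- The curve is symmetric about the z-axis, so a zero u of the abscissa pairs with -u.
  refine ⟨ellipticF m u / c, ellipticF m (-u) / c, ?_, (h.meets_iff hc hm0 hm _ _).2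
    ⟨by linarith [hu.1], by rw [abscissa_neg, hz, neg_zero], by rw [cos_neg]⟩⟩
  have h1 := ellipticF_strictMono hm hu.1
  have h2 := ellipticF_strictMono hm hu.2
  rw [ellipticF_zero] at h1
  rw [ellipticF_neg, ← sub_div, sub_neg_eq_add, abs_of_pos (by positivity)]
  gcongr
  linarith

lemma meetsTangentially (hc : 0 < c) (hm0 : 1 / 2 < m) (hm : m < 1)
    (h : IsDirectrix (-c ^ 2) (-(2 * √m / c)) x z) (heq : 2 * retreat m = advance m) {s t : ℝ}
    (hst : Meets x z s t) : MeetsTangentially x z s t := by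
  refine ⟨hst, ?_⟩
  have := retreat_pos hm0 hm
  obtain ⟨φ, n, rfl, rfl, h1, h2⟩ := h.exists_of_meets hc hm0 hm (by linarith) hst
  rw [h.parallelTangents_iff hc hm0 hm]
  exact Or.inl ((abscissa_eq_int_mul_of_eq hm0 hm heq h2).resolve_left h1)

lemma x_nonneg (hc : 0 < c) (hm0 : 1 / 2 < m) (hm : m < 1)
    (h : IsDirectrix (-c ^ 2) (-(2 * √m / c)) x z) (heq : 2 * retreat m = advance m) {s : ℝ}
    (hs : 0 ≤ s) : 0 ≤ x s := by
  obtain ⟨φ, rfl⟩ := exists_amplitude hc hm s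
  have hr := retreat_pos hm0 hm
  have hφ : 0 ≤ φ := by
    rw [← (ellipticF_strictMono hm).le_iff_le, ellipticF_zero]
    simpa using (le_div_iff₀ hc).1 hs
  rw [(h.amplitude hc (by linarith) hm φ).1]
  refine div_nonneg ?_ hc.le
  obtain ⟨u, hu, n, rfl⟩ := exists_eq_add_int_mul_pi φ
  have hn : (0 : ℝ) ≤ n := by
    have : (-1 : ℝ) < n := by
      by_contra! hc
      nlinarith [hu.2, pi_pos]
    have : (-1 : ℤ) < n := by exact_mod_cast this
    exact_mod_cast (show (0 : ℤ) ≤ n by omega)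
  rw [abscissa_add_int_mul_pi hm, abscissa_pi hm]
  have h1 := (abscissa_nonneg_of_eq hm0 hm heq ⟨hu.1, hu.2.le⟩).1
  have h2 := mul_nonneg hn (show 0 ≤ 2 * (advance m - retreat m) by linarith)
  linarith

/-- Away from the two thresholds, double points within one period are transversal. -/
lemma meetsTransversally_of_lt_period (hc : 0 < c) (hm0 : 1 / 2 < m) (hm : m < 1)
    (h : IsDirectrix (-c ^ 2) (-(2 * √m / c)) x z) (hne : advance m ≠ retreat m)
    (hne' : 2 * retreat m ≠ advance m) {s t : ℝ} (hlt : |s - t| < 2 * ellipticF m π / c)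
    (hst : Meets x z s t) : MeetsTransversally x z s t := by
  refine ⟨hst, fun hpar => hne' ?_⟩
  obtain ⟨φ, n, rfl, rfl, h1, h2⟩ := h.exists_of_meets hc hm0 hm hne hst
  have h3 := mul_sin_sq_eq_half hm hne h1 h2 ((h.parallelTangents_iff hc hm0 hm φ n).1 hpar)
  obtain ⟨h4, h5⟩ := abs_lt.1 hlt
  have h6 : ellipticF m φ / c < ellipticF m (-φ + (2 * n : ℤ) * π + (2 : ℤ) * π) / c := by
    rw [← amplitude_add_period hm]; linarith
  have h7 : ellipticF m (-φ + (2 * n : ℤ) * π) / c < ellipticF m (φ + (2 : ℤ) * π) / c := by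
    rw [← amplitude_add_period hm]; linarith
  rw [div_lt_div_iff_of_pos_right hc, (ellipticF_strictMono hm).lt_iff_lt] at h6 h7
  push_cast at h6 h7
  -- Less than a period apart means |2φ - 2nπ| < 2π, so the shifted amplitude φ - nπ lies in (-π, π)
  -- and is a critical zero of the abscissa.
  have e : φ = (φ + (-n : ℤ) * π) + n * π := by push_cast; ring
  refine two_retreat_eq_of_abscissa_eq_zero hm0 hm (u := φ + (-n : ℤ) * π) ⟨?_, ?_⟩ ?_ ?_
  · push_cast; linarith
  · push_cast; linarith
  · rw [abscissa_add_int_mul_pi hm, h2]; push_cast; ring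
  · rw [sin_add_int_mul_pi_sq, h3]

/-- A tangential double point of a curve that is not closed forces a resonance. -/
lemma meetsTransversally_of_not_resonance (hc : 0 < c) (hm0 : 1 / 2 < m) (hm : m < 1)
    (h : IsDirectrix (-c ^ 2) (-(2 * √m / c)) x z) (hne : advance m ≠ retreat m)
    (hres : ¬ ∃ j : ℤ, advance m = 2 * j * (advance m - retreat m)) {s t : ℝ}
    (hst : Meets x z s t) : MeetsTransversally x z s t := by
  refine ⟨hst, fun hpar => hres ?_⟩
  obtain ⟨φ, n, rfl, rfl, h1, h2⟩ := h.exists_of_meets hc hm0 hm hne hst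
  exact exists_resonance hm0 hm h2
    (mul_sin_sq_eq_half hm hne h1 h2 ((h.parallelTangents_iff hc hm0 hm φ n).1 hpar))

/-- At the second threshold the curve is closed. -/
lemma x_periodic (hc : 0 < c) (hm0 : 1 / 2 < m) (hm : m < 1)
    (h : IsDirectrix (-c ^ 2) (-(2 * √m / c)) x z) (heq : retreat m = advance m) :
    Periodic x (2 * ellipticF m π / c) := fun s => by
  rw [h.x_add_period hc hm0 hm, h.x_period hc hm0 hm, heq]; simp

/-- At the second threshold the origin is the only double point. -/
lemma double_point_iff (hc : 0 < c) (hm0 : 1 / 2 < m) (hm : m < 1)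
    (h : IsDirectrix (-c ^ 2) (-(2 * √m / c)) x z) (heq : retreat m = advance m) (p : ℝ × ℝ) :
    (∃ s ∈ Ico 0 (2 * ellipticF m π / c), ∃ t ∈ Ico 0 (2 * ellipticF m π / c),
      Meets x z s t ∧ (x s, z s) = p) ↔ p = (0, 0) := by
  have hT : 2 * ellipticF m π / c = ellipticF m (2 * π) / c := by
    have := amplitude_add_period (c := c) hm 0
    simpa [ellipticF_zero] using this
  have hmem : ∀ φ, ellipticF m φ / c ∈ Ico 0 (2 * ellipticF m π / c) ↔ φ ∈ Ico 0 (2 * π) := by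
    intro φ
    have h0 : 0 ≤ ellipticF m φ ↔ 0 ≤ φ := by
      rw [← (ellipticF_strictMono hm).le_iff_le (a := 0) (b := φ), ellipticF_zero]
    rw [hT, mem_Ico, mem_Ico, le_div_iff₀ hc, zero_mul, div_lt_div_iff_of_pos_right hc,
      (ellipticF_strictMono hm).lt_iff_lt, h0]
  have hP : abscissa m π = 0 := by rw [abscissa_pi hm, heq]; ring
  have hper : ∀ φ, abscissa m (2 * π - φ) = -abscissa m φ := by
    intro φ
    have := abscissa_add_int_mul_pi hm (-φ) 2
    rw [hP, abscissa_neg] at this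
    rw [sub_eq_neg_add]
    simpa using this
  have h1 := h.amplitude hc (by linarith) hm
  have hA : abscissa m (π / 2) = 0 := by rw [advance_sub_retreat hm, heq, sub_self]
  constructor
  · rintro ⟨s, hs, t, ht, hst, rfl⟩
    obtain ⟨φ, rfl⟩ := exists_amplitude hc hm s
    obtain ⟨ψ, rfl⟩ := exists_amplitude hc hm t
    rw [hmem] at hs ht
    obtain ⟨hne, h2, h3⟩ := (h.meets_iff hc hm0 hm φ ψ).1 hst
    -- In one period the mirror relation survives only with n = 1; n = 0 would give φ = ψ = 0.
    have hψ : ψ = 2 * π - φ := by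
      obtain ⟨n, hn | hn⟩ := cos_eq_cos_iff.1 h3
      · exfalso
        have hn1 : (n : ℝ) < 1 := by
          by_contra! hc
          nlinarith [hs.1, ht.2, pi_pos]
        have hn2 : (-1 : ℝ) < n := by
          by_contra! hc
          nlinarith [hs.2, ht.1, pi_pos]
        norm_cast at hn1
        have hn3 : (-1 : ℤ) < n := by exact_mod_cast hn2
        obtain rfl : n = 0 := by omega
        exact hne (by simpa using hn.symm)
      · have hn1 : (n : ℝ) < 2 := by
          by_contra! hc
          nlinarith [hs.2, ht.2, pi_pos]
        have hn2 : (-1 : ℝ) < n := by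
          by_contra! hc
          nlinarith [hs.1, ht.1, pi_pos]
        norm_cast at hn1
        have hn3 : (-1 : ℤ) < n := by exact_mod_cast hn2
        obtain rfl | rfl : n = 0 ∨ n = 1 := by omega
        · exact absurd (by push_cast at hn; linarith [hs.1, ht.1]) hne
        · rw [hn]; push_cast; ring
    subst hψ
    have hz : abscissa m φ = 0 := by linarith [hper φ]
    have hpos : 0 < φ := by linarith [ht.2]
    -- The abscissa vanishes at φ ≠ π, so φ is π/2 or its mirror 3π/2, where the height is 0.
    have hφ : cos φ = 0 := by
      rcases lt_trichotomy φ π with h' | h' | h'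
      · rw [eq_pi_div_two_of_abscissa_eq_zero hm0 hm heq ⟨hpos, h'⟩ hz, cos_pi_div_two]
      · exact absurd (by rw [h']; ring) hne
      · have := eq_pi_div_two_of_abscissa_eq_zero hm0 hm heq (u := 2 * π - φ)
          ⟨by linarith [hs.2], by linarith⟩ (by rw [hper, hz, neg_zero])
        rw [h3, this, cos_pi_div_two]
    rw [(h1 φ).1, (h1 φ).2.1, hz, hφ, zero_div, mul_zero]
  · rintro rfl
    have hp := pi_pos
    have hcos : cos (2 * π - π / 2) = 0 := by rw [cos_two_pi_sub, cos_pi_div_two]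
    refine ⟨ellipticF m (π / 2) / c, (hmem _).2 ⟨by positivity, by linarith⟩,
      ellipticF m (2 * π - π / 2) / c, (hmem _).2 ⟨by linarith, by linarith⟩,
      (h.meets_iff hc hm0 hm _ _).2 ⟨by intro h; linarith, ?_, ?_⟩, ?_⟩
    · rw [hper, hA, neg_zero]
    · rw [hcos, cos_pi_div_two]
    · rw [(h1 _).1, (h1 _).2.1, hA, cos_pi_div_two, zero_div, mul_zero]

end IsDirectrix

/-! ### Translation from parameters to heights, and conclusion -/

lemma neg_two_mul_sqrt_div_lt_iff {c m m' : ℝ} (hc : 0 < c) (hm : 0 ≤ m) :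
    -(2 * √m' / c) < -(2 * √m / c) ↔ m < m' := by
  rw [neg_lt_neg_iff, div_lt_div_iff_of_pos_right hc, mul_lt_mul_iff_right₀ two_pos,
    Real.sqrt_lt_sqrt_iff hm]

end CapillaryChannel

open CapillaryChannel Set Real

theorem mainTheorem3 (κ : ℝ) (hκ : κ < 0) :
    ∃ z₁ z₂ : ℝ, -(2 / Real.sqrt (-κ)) < z₂ ∧ z₂ < z₁ ∧ z₁ < -(Real.sqrt 2 / Real.sqrt (-κ)) ∧
    ∃ B : Set ℝ, B.Countable ∧
    ∀ z₀ : ℝ, -(2 / Real.sqrt (-κ)) < z₀ → z₀ < -Real.sqrt (-2 / κ) →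
    ∀ x z : ℝ → ℝ, CapillaryChannel.IsDirectrix κ z₀ x z →
    ∃ T : ℝ, CapillaryChannel.IsLeastPeriod z T ∧ (∀ s, x (s + T) = x s + x T) ∧
      -- no double points, drift to the right
      (z₁ < z₀ →
        (∀ s t, ¬ CapillaryChannel.Meets x z s t) ∧ Tendsto x atTop atTop) ∧
      -- double points, all of them tangential, drift to the right
      (z₀ = z₁ →
        (∃ s t, CapillaryChannel.Meets x z s t) ∧
        (∀ s t, CapillaryChannel.Meets x z s t → CapillaryChannel.MeetsTangentially x z s t) ∧
        (∀ s, 0 ≤ s → 0 ≤ x s) ∧ Tendsto x atTop atTop) ∧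
      -- transversal double points, drift to the right
      (z₂ < z₀ → z₀ < z₁ →
        (∃ s t, |s - t| < T ∧ CapillaryChannel.MeetsTransversally x z s t) ∧
        (∀ s t, |s - t| < T → CapillaryChannel.Meets x z s t →
          CapillaryChannel.MeetsTransversally x z s t) ∧
        (z₀ ∉ B → ∀ s t, CapillaryChannel.Meets x z s t →
          CapillaryChannel.MeetsTransversally x z s t) ∧
        Tendsto x atTop atTop) ∧
      -- closed curve whose only double point is the origin
      (z₀ = z₂ →
        Function.Periodic x T ∧
        ∀ p : ℝ × ℝ,
          (∃ s ∈ Set.Ico 0 T, ∃ t ∈ Set.Ico 0 T,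
            CapillaryChannel.Meets x z s t ∧ (x s, z s) = p) ↔ p = (0, 0)) ∧
      -- transversal double points, drift to the left
      (z₀ < z₂ →
        (∃ s t, |s - t| < T ∧ CapillaryChannel.MeetsTransversally x z s t) ∧
        (∀ s t, |s - t| < T → CapillaryChannel.Meets x z s t →
          CapillaryChannel.MeetsTransversally x z s t) ∧
        (z₀ ∉ B → ∀ s t, CapillaryChannel.Meets x z s t →
          CapillaryChannel.MeetsTransversally x z s t) ∧
        Tendsto x atTop atBot) := by
  obtain ⟨c, hc, rfl⟩ : ∃ c, 0 < c ∧ κ = -c ^ 2 :=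
    ⟨√(-κ), Real.sqrt_pos.2 (by linarith), by rw [Real.sq_sqrt (by linarith)]; ring⟩
  rw [neg_neg, Real.sqrt_sq hc.le]
  obtain ⟨m₁, m₂, hm₁, h12, hm₂, e₁, e₂⟩ := exists_thresholds
  -- The bounds on z₀ are the heights belonging to m = 1 and m = 1/2.
  have hg1 : -(2 / c) = -(2 * √1 / c) := by simp
  have hs2 : 2 * √(1 / 2) = √2 := by
    rw [Real.sqrt_div zero_le_one, Real.sqrt_one, mul_one_div, Real.div_sqrt]
  have hg2 : -(√2 / c) = -(2 * √(1 / 2) / c) := by rw [hs2]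
  refine ⟨-(2 * √m₁ / c), -(2 * √m₂ / c), ?_, ?_, ?_,
    ⋃ j : ℤ, (fun m => -(2 * √m / c)) ''
      {m : ℝ | 1 / 2 < m ∧ m < 1 ∧ advance m = 2 * j * (advance m - retreat m)}, ?_, ?_⟩
  · rwa [hg1, neg_two_mul_sqrt_div_lt_iff hc (by linarith)]
  · rwa [neg_two_mul_sqrt_div_lt_iff hc (by linarith)]
  · rwa [hg2, neg_two_mul_sqrt_div_lt_iff hc (by norm_num)]
  · exact countable_iUnion fun j => ((subsingleton_resonance j).image _).countable
  intro z₀ hz1 hz2 x z h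
  obtain ⟨m, hm, rfl⟩ : ∃ m, 0 ≤ m ∧ z₀ = -(2 * √m / c) := by
    refine ⟨(c * z₀ / 2) ^ 2, sq_nonneg _, ?_⟩
    have hz : z₀ < 0 := hz2.trans_le (neg_nonpos.2 (Real.sqrt_nonneg _))
    rw [Real.sqrt_sq_eq_abs, abs_of_neg (by nlinarith)]
    field_simp
  rw [hg1, neg_two_mul_sqrt_div_lt_iff hc hm] at hz1
  rw [neg_div_neg_eq, Real.sqrt_div zero_le_two, Real.sqrt_sq hc.le, hg2,
    neg_two_mul_sqrt_div_lt_iff hc (by norm_num)] at hz2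
  have ha := advance_pos hz1
  have hr := retreat_pos hz2 hz1
  have heq : ∀ m', 0 ≤ m' → -(2 * √m / c) = -(2 * √m' / c) → m = m' := by
    intro m' hm' e
    refine le_antisymm ?_ ?_
    · exact not_lt.1 fun hlt => ((neg_two_mul_sqrt_div_lt_iff hc hm').2 hlt).ne e
    · exact not_lt.1 fun hlt => ((neg_two_mul_sqrt_div_lt_iff hc hm).2 hlt).ne e.symm
  have hres : -(2 * √m / c) ∉ (⋃ j : ℤ, (fun m => -(2 * √m / c)) ''
      {m : ℝ | 1 / 2 < m ∧ m < 1 ∧ advance m = 2 * j * (advance m - retreat m)}) →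
      ¬ ∃ j : ℤ, advance m = 2 * j * (advance m - retreat m) := by
    rintro hB ⟨j, hj⟩
    exact hB (mem_iUnion.2 ⟨j, m, ⟨hz2, hz1, hj⟩, rfl⟩)
  -- R - A/2 vanishes at m₁ and is strictly increasing.
  have hbeyond : m₁ < m → advance m < 2 * retreat m := fun hlt => by
    linarith [retreat_sub_mul_advance_strictMono one_half_pos.le hlt hm₁.le hz1]
  refine ⟨2 * ellipticF m π / c, h.isLeastPeriod hc hz2 hz1, h.x_add_period hc hz2 hz1,
    fun hlt => ?_, fun e => ?_, fun hlt hlt' => ?_, fun e => ?_, fun hlt => ?_⟩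
  · rw [neg_two_mul_sqrt_div_lt_iff hc hm] at hlt
    have h2 : 2 * retreat m < advance m := by
      linarith [retreat_sub_mul_advance_strictMono one_half_pos.le hlt hz2.le (h12.trans hm₂)]
    exact ⟨h.not_meets hc hz2 hz1 h2, h.tendsto_atTop hc hz2 hz1 (by linarith)⟩
  · obtain rfl := heq m₁ (by linarith) e
    obtain ⟨s, t, -, hst⟩ := h.exists_meets hc hz2 hz1 e₁.ge
    exact ⟨⟨s, t, hst⟩, fun s t => h.meetsTangentially hc hz2 hz1 e₁,
      fun s => h.x_nonneg hc hz2 hz1 e₁, h.tendsto_atTop hc hz2 hz1 (by linarith)⟩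
  · rw [neg_two_mul_sqrt_div_lt_iff hc hm] at hlt
    rw [neg_two_mul_sqrt_div_lt_iff hc (by linarith)] at hlt'
    have h1 := hbeyond hlt'
    have h2 := retreat_sub_mul_advance_strictMono zero_le_one hlt hz2.le hm₂
    have h3 : retreat m < advance m := by linarith
    have htr := fun s t => h.meetsTransversally_of_lt_period hc hz2 hz1 h3.ne' h1.ne'
      (s := s) (t := t)
    obtain ⟨s, t, hst, hmeet⟩ := h.exists_meets hc hz2 hz1 h1.le
    exact ⟨⟨s, t, hst, htr s t hst hmeet⟩, htr,
      fun hB s t => h.meetsTransversally_of_not_resonance hc hz2 hz1 h3.ne' (hres hB),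
      h.tendsto_atTop hc hz2 hz1 h3⟩
  · obtain rfl := heq m₂ (by linarith) e
    exact ⟨h.x_periodic hc hz2 hz1 e₂, h.double_point_iff hc hz2 hz1 e₂⟩
  · rw [neg_two_mul_sqrt_div_lt_iff hc (by linarith)] at hlt
    have h1 := hbeyond (h12.trans hlt)
    have h2 := retreat_sub_mul_advance_strictMono zero_le_one hlt (hm₁.trans h12).le hz1
    have h3 : advance m < retreat m := by linarith
    have htr := fun s t => h.meetsTransversally_of_lt_period hc hz2 hz1 h3.ne h1.ne'
      (s := s) (t := t)
    obtain ⟨s, t, hst, hmeet⟩ := h.exists_meets hc hz2 hz1 h1.le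
    exact ⟨⟨s, t, hst, htr s t hst hmeet⟩, htr,
      fun hB s t => h.meetsTransversally_of_not_resonance hc hz2 hz1 h3.ne (hres hB),
      h.tendsto_atBot hc hz2 hz1 h3⟩
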